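/- Let $M$ be a compact $C^1$ manifold without boundary with a continuous Riemannian metric, let $\mathrm{dist}$ be the Riemannian distance (equal to $\infty$ between points of different connected components), and let $f:M\to M$ be an Anosov diffeomorphism of class $C^1$. That is, there are $K>0$, $0<\lambda<1$ and subspaces $S_x,U_x\subseteq T_xM$, varying continuously with $x$, such that for all $x\in M$: $S_x\oplus U_x=T_xM$; $f'_xS_x=S_{f(x)}$ and $f'_xU_x=U_{f(x)}$; $\|(f^n)'_x s\|\le K\lambda^{n}\|s\|$ for $s\in S_x$, $n\ge 0$; $\|(f^n)'_x u\|\le K\lambda^{-n}\|u\|$ for $u\in U_x$, $n\le 0$. For $\epsilon>0$ and $x\in M$ put $$W^s_\epsilon(x)=\{y\in M:\mathrm{dist}(f^n(x),f^n(y))\le\epsilon\ \ \forall n\ge 0\},\qquad W^u_\epsilon(x)=\{y\in M:\mathrm{dist}(f^n(x),f^n(y))\le\epsilon\ \ \forall n\le 0\}.$$ A number $\rho>0$ is called an expansivity constant of $f$ if, for all $x,y\in M$, one has $\mathrm{dist}(f^n(x),f^n(y))\le\rho$ for all $n\in\mathbb Z$ if and only if $x=y$. Then $f$ has an expansivity constant.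 Moreover, for every expansivity constant $\rho$ of $f$ and every $0<\epsilon\le\rho/2$, there is $\delta>0$ such that $(\ast)$ for all $x,y\in M$ with $\mathrm{dist}(x,y)<\delta$, the set $W^s_\epsilon(x)\cap W^u_\epsilon(y)$ consists of exactly one point, denoted $[x,y]$. Finally, for every $\delta>0$ satisfying $(\ast)$ there is $\bar\epsilon>0$ such that for every $x\in M$: every $(z,w)\in W^u_{\bar\epsilon}(x)\times W^s_{\bar\epsilon}(x)$ satisfies $\mathrm{dist}(z,w)<\delta$, and the bracket map $(z,w)\mapsto[z,w]$ is a homeomorphism of $W^u_{\bar\epsilon}(x)\times W^s_{\bar\epsilon}(x)$ onto a neighbourhood of $x$ in $M$. -/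

import Mathlib

open Bundle Manifold Topology

noncomputable section

/-- A family of tangent subspaces `S x ⊆ T_x M` varies continuously with `x`: near every point it
is spanned by a local frame of linearly independent continuous vector fields. -/
def ContinuousSubspaceFamily {E : Type*} [NormedAddCommGroup E] [NormedSpace ℝ E]
    {M : Type*} [TopologicalSpace M] [ChartedSpace E M] [IsManifold 𝓘(ℝ, E) 1 M]
    (S : ∀ x : M, Submodule ℝ (TangentSpace 𝓘(ℝ, E) x)) : Prop :=
  ∀ x₀ : M, ∃ (k : ℕ) (V : Set M) (e : Fin k → ∀ x : M, TangentSpace 𝓘(ℝ, E) x),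
    V ∈ 𝓝 x₀ ∧
    (∀ i, ContinuousOn (fun x : M => (⟨x, e i x⟩ : TangentBundle 𝓘(ℝ, E) M)) V) ∧
    ∀ x ∈ V, LinearIndependent ℝ (fun i => e i x) ∧
      Submodule.span ℝ (Set.range fun i => e i x) = S x

/-- `f` is an Anosov diffeomorphism. Integer iterates `f ^ n` are taken in the group of
permutations of `M`, and `‖·‖` is the Riemannian norm of the tangent spaces. -/
def IsAnosov {E : Type*} [NormedAddCommGroup E] [NormedSpace ℝ E]
    {M : Type*} [TopologicalSpace M] [ChartedSpace E M] [IsManifold 𝓘(ℝ, E) 1 M]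
    [RiemannianBundle (fun x : M => TangentSpace 𝓘(ℝ, E) x)]
    (f : Diffeomorph 𝓘(ℝ, E) 𝓘(ℝ, E) M M 1) : Prop :=
  ∃ (K r : ℝ) (S U : ∀ x : M, Submodule ℝ (TangentSpace 𝓘(ℝ, E) x)),
    0 < K ∧ 0 < r ∧ r < 1 ∧
    ContinuousSubspaceFamily S ∧ ContinuousSubspaceFamily U ∧
    (∀ x, IsCompl (S x) (U x)) ∧
    (∀ x, (S x).map (mfderiv 𝓘(ℝ, E) 𝓘(ℝ, E) f x).toLinearMap = S (f x)) ∧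
    (∀ x, (U x).map (mfderiv 𝓘(ℝ, E) 𝓘(ℝ, E) f x).toLinearMap = U (f x)) ∧
    (∀ (x : M), ∀ s ∈ S x, ∀ n : ℤ, 0 ≤ n →
      ‖mfderiv 𝓘(ℝ, E) 𝓘(ℝ, E) (⇑((f.toEquiv : Equiv.Perm M) ^ n)) x s‖ ≤ K * r ^ n * ‖s‖) ∧
    (∀ (x : M), ∀ u ∈ U x, ∀ n : ℤ, n ≤ 0 →
      ‖mfderiv 𝓘(ℝ, E) 𝓘(ℝ, E) (⇑((f.toEquiv : Equiv.Perm M) ^ n)) x u‖ ≤ K * r ^ (-n) * ‖u‖)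

/-- `ρ` is a constant of expansivity of the bijection `f`. -/
def IsExpansivityConstant {M : Type*} [EMetricSpace M] (f : Equiv.Perm M) (ρ : ℝ) : Prop :=
  0 < ρ ∧ ∀ x y : M,
    (∀ n : ℤ, edist ((f ^ n) x) ((f ^ n) y) ≤ ENNReal.ofReal ρ) ↔ x = y

/-- The `ε`-stable set of `x`. -/
def localStableSet {M : Type*} [EMetricSpace M] (f : Equiv.Perm M) (ε : ℝ) (x : M) : Set M :=
  {y | ∀ n : ℤ, 0 ≤ n → edist ((f ^ n) x) ((f ^ n) y) ≤ ENNReal.ofReal ε}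

/-- The `ε`-unstable set of `x`. -/
def localUnstableSet {M : Type*} [EMetricSpace M] (f : Equiv.Perm M) (ε : ℝ) (x : M) : Set M :=
  {y | ∀ n : ℤ, n ≤ 0 → edist ((f ^ n) x) ((f ^ n) y) ≤ ENNReal.ofReal ε}

/-- At scale `(ε, δ)` the bracket is well defined: the `ε`-stable set of `x` and the `ε`-unstable
set of `y` meet in exactly one point whenever `dist (x, y) < δ`. -/
def BracketDefined {M : Type*} [EMetricSpace M] (f : Equiv.Perm M) (ε δ : ℝ) : Prop :=
  ∀ x y : M, edist x y < ENNReal.ofReal δ →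
    ∃! z, z ∈ localStableSet f ε x ∩ localUnstableSet f ε y

/-- The bracket `[x, y]`, the unique point of `W^s_ε(x) ∩ W^u_ε(y)`, as a map on
`{(x, y) : dist (x, y) < δ}`. -/
def bracket {M : Type*} [EMetricSpace M] {f : Equiv.Perm M} {ε δ : ℝ}
    (h : BracketDefined f ε δ) (p : {p : M × M // edist p.1 p.2 < ENNReal.ofReal δ}) : M :=
  (h p.1.1 p.1.2 p.2).choose

end

/-! No stable manifolds are constructed: expansivity and the bracket both come from one contraction
on bi-infinite sequences. Pass to `g = f ^ N` with `N` so large that `K * r ^ N` beats the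
distortion of a finite atlas. In charts along a pseudo-orbit, `g` becomes a sequence of maps `G n`
that contract along the range of a projection and have approximate inverses `R n` along the kernel.
The stable component of `v n` is then determined by the past and the unstable one by the future.
This makes orbits the fixed points of `orbitMap`, a 3/4-contraction in the sup norm.

Uniqueness of the fixed point (`eq_of_hyperbolic_orbits`) gives expansivity; existence
(`exists_hyperbolic_orbit`) gives shadowing. Shadowing the forward orbit of `x` glued to the
backward orbit of `y` produces a point of `W^s(x) ∩ W^u(y)`. Both conclusions descend from `f ^ N`
to `f`.

The rest is topology (`localProductStructure_of_hasLocalIntersections`). Expansivity makes the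
intersection point unique, a closed graph over a compact space makes the bracket continuous, and
`z`, `w` are recovered from `p = [z,w]` as `[p,x]`, `[x,p]`. -/

/-! ### Local stable and unstable sets and the topology of the bracket. -/

section LocalSets

variable {M : Type*} [EMetricSpace M] {f : Equiv.Perm M}

theorem isClosed_localStableSet_graph (hc : ∀ n : ℤ, Continuous (f ^ n)) (ε : ℝ) :
    IsClosed {p : M × M | p.2 ∈ localStableSet f ε p.1} := by
  have : {p : M × M | p.2 ∈ localStableSet f ε p.1} =
      ⋂ (n : ℤ) (_ : 0 ≤ n), {p | edist ((f ^ n) p.1) ((f ^ n) p.2) ≤ ENNReal.ofReal ε} := by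
    ext; simp [localStableSet]
  rw [this]
  refine isClosed_iInter fun n => isClosed_iInter fun _ => ?_
  exact isClosed_le (((hc n).comp continuous_fst).edist ((hc n).comp continuous_snd))
    continuous_const

theorem isClosed_localUnstableSet_graph (hc : ∀ n : ℤ, Continuous (f ^ n)) (ε : ℝ) :
    IsClosed {p : M × M | p.2 ∈ localUnstableSet f ε p.1} := by
  have : {p : M × M | p.2 ∈ localUnstableSet f ε p.1} =
      ⋂ (n : ℤ) (_ : n ≤ 0), {p | edist ((f ^ n) p.1) ((f ^ n) p.2) ≤ ENNReal.ofReal ε} := by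
    ext; simp [localUnstableSet]
  rw [this]
  refine isClosed_iInter fun n => isClosed_iInter fun _ => ?_
  exact isClosed_le (((hc n).comp continuous_fst).edist ((hc n).comp continuous_snd))
    continuous_const

theorem isClosed_localStableSet (hc : ∀ n : ℤ, Continuous (f ^ n)) (ε : ℝ) (x : M) :
    IsClosed (localStableSet f ε x) :=
  (isClosed_localStableSet_graph hc ε).preimage (Continuous.prodMk_right x)

theorem isClosed_localUnstableSet (hc : ∀ n : ℤ, Continuous (f ^ n)) (ε : ℝ) (x : M) :
    IsClosed (localUnstableSet f ε x) :=
  (isClosed_localUnstableSet_graph hc ε).preimage (Continuous.prodMk_right x)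

theorem mem_localStableSet_comm {ε : ℝ} {x y : M} :
    y ∈ localStableSet f ε x ↔ x ∈ localStableSet f ε y := by
  simp only [localStableSet, Set.mem_ofPred_eq, edist_comm]

theorem mem_localUnstableSet_comm {ε : ℝ} {x y : M} :
    y ∈ localUnstableSet f ε x ↔ x ∈ localUnstableSet f ε y := by
  simp only [localUnstableSet, Set.mem_ofPred_eq, edist_comm]

theorem localStableSet_mono {ε ε' : ℝ} (h : ε ≤ ε') (x : M) :
    localStableSet f ε x ⊆ localStableSet f ε' x :=
  fun _ hy n hn => (hy n hn).trans (ENNReal.ofReal_le_ofReal h)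

theorem localUnstableSet_mono {ε ε' : ℝ} (h : ε ≤ ε') (x : M) :
    localUnstableSet f ε x ⊆ localUnstableSet f ε' x :=
  fun _ hy n hn => (hy n hn).trans (ENNReal.ofReal_le_ofReal h)

theorem edist_le_of_mem_localStableSet {ε : ℝ} {x y : M} (h : y ∈ localStableSet f ε x) :
    edist x y ≤ ENNReal.ofReal ε := by
  simpa using h 0 le_rfl

theorem edist_le_of_mem_localUnstableSet {ε : ℝ} {x y : M} (h : y ∈ localUnstableSet f ε x) :
    edist x y ≤ ENNReal.ofReal ε := by
  simpa using h 0 le_rfl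

/-- Two such points stay within `2ε ≤ ρ` of each other: compare through the orbit of `x` in forward
time and of `y` in backward time. -/
theorem IsExpansivityConstant.eq_of_mem {ρ ε : ℝ} (hρ : IsExpansivityConstant f ρ) (hε : 0 < ε)
    (hερ : ε ≤ ρ / 2) {x y z z' : M} (hz : z ∈ localStableSet f ε x ∩ localUnstableSet f ε y)
    (hz' : z' ∈ localStableSet f ε x ∩ localUnstableSet f ε y) : z = z' := by
  refine (hρ.2 z z').1 fun n => ?_
  have key : ∀ w : M, edist w ((f ^ n) z) ≤ ENNReal.ofReal ε →
      edist w ((f ^ n) z') ≤ ENNReal.ofReal ε →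
      edist ((f ^ n) z) ((f ^ n) z') ≤ ENNReal.ofReal ρ := by
    intro w h1 h2
    calc edist ((f ^ n) z) ((f ^ n) z') ≤ edist ((f ^ n) z) w + edist w ((f ^ n) z') :=
          edist_triangle _ _ _
      _ ≤ ENNReal.ofReal ε + ENNReal.ofReal ε := by
          rw [edist_comm _ w]; exact add_le_add h1 h2
      _ = ENNReal.ofReal (ε + ε) := (ENNReal.ofReal_add hε.le hε.le).symm
      _ ≤ ENNReal.ofReal ρ := ENNReal.ofReal_le_ofReal (by linarith)
  rcases le_total 0 n with hn | hn
  · exact key _ (hz.1 n hn) (hz'.1 n hn)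
  · exact key _ (hz.2 n hn) (hz'.2 n hn)

/-- Nearby points have intersecting local stable and unstable sets, at every scale. -/
def HasLocalIntersections (f : Equiv.Perm M) : Prop :=
  ∀ ε : ℝ, 0 < ε → ∃ δ : ℝ, 0 < δ ∧ ∀ x y : M, edist x y < ENNReal.ofReal δ →
    (localStableSet f ε x ∩ localUnstableSet f ε y).Nonempty

theorem bracket_mem {ε δ : ℝ} (h : BracketDefined f ε δ)
    (p : {p : M × M // edist p.1 p.2 < ENNReal.ofReal δ}) :
    bracket h p ∈ localStableSet f ε p.1.1 ∩ localUnstableSet f ε p.1.2 :=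
  (h p.1.1 p.1.2 p.2).choose_spec.1

/-- The graph is closed by uniqueness of the intersection point, and projection along a compact
factor is a closed map. -/
theorem continuous_bracket [CompactSpace M] (hc : ∀ n : ℤ, Continuous (f ^ n)) {ε δ : ℝ}
    (h : BracketDefined f ε δ) : Continuous (bracket h) := by
  refine continuous_iff_isClosed.2 fun s hs => ?_
  have hK : IsClosed {q : {p : M × M // edist p.1 p.2 < ENNReal.ofReal δ} × M |
      q.2 ∈ localStableSet f ε q.1.1.1 ∩ localUnstableSet f ε q.1.1.2 ∧ q.2 ∈ s} := by
    refine IsClosed.inter (IsClosed.inter ?_ ?_) (hs.preimage continuous_snd)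
    · exact (isClosed_localStableSet_graph hc ε).preimage
        (((continuous_fst.comp continuous_subtype_val).comp continuous_fst).prodMk continuous_snd)
    · exact (isClosed_localUnstableSet_graph hc ε).preimage
        (((continuous_snd.comp continuous_subtype_val).comp continuous_fst).prodMk continuous_snd)
  convert isClosedMap_fst_of_compactSpace _ hK using 1
  ext p
  simp only [Set.mem_preimage, Set.mem_image, Set.mem_ofPred_eq]
  constructor
  · intro hp
    exact ⟨(p, bracket h p), ⟨bracket_mem h p, hp⟩, rfl⟩
  · rintro ⟨⟨q, z⟩, ⟨hz, hzs⟩, rfl⟩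
    have : bracket h q = z := (h _ _ q.2).unique (bracket_mem h q) hz
    rwa [this]

/-- The topological half of the local product structure: an expansive homeomorphism with
intersecting local stable and unstable sets has canonical coordinates. -/
theorem localProductStructure_of_hasLocalIntersections [CompactSpace M]
    (hc : ∀ n : ℤ, Continuous (f ^ n)) (hI : HasLocalIntersections f)
    {ρ : ℝ} (hρ : IsExpansivityConstant f ρ) {ε : ℝ} (hε : 0 < ε) (hερ : ε ≤ ρ / 2) :
    (∃ δ : ℝ, 0 < δ ∧ BracketDefined f ε δ) ∧
      ∀ δ : ℝ, 0 < δ → ∀ h : BracketDefined f ε δ,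
        ∃ ε' : ℝ, 0 < ε' ∧ ∀ x : M,
          ∃ (hsub : ∀ z ∈ localUnstableSet f ε' x, ∀ w ∈ localStableSet f ε' x,
              edist z w < ENNReal.ofReal δ)
            (V : Set M)
            (φ : ↥(localUnstableSet f ε' x) × ↥(localStableSet f ε' x) ≃ₜ ↥V),
            V ∈ 𝓝 x ∧
            ∀ p, (φ p : M) = bracket h ⟨(p.1.1, p.2.1), hsub p.1.1 p.1.2 p.2.1 p.2.2⟩ := by
  constructor
  · obtain ⟨δ, hδ, H⟩ := hI ε hε
    exact ⟨δ, hδ, fun x y hxy => existsUnique_of_exists_of_unique (H x y hxy)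
      fun z z' hz hz' => hρ.eq_of_mem hε hερ hz hz'⟩
  intro δ hδ h
  -- `2ε' < δ` puts the product inside the domain of the bracket; `ε' ≤ ε` lets uniqueness at scale
  -- `ε` apply. Neither depends on `x`.
  obtain ⟨ε', hε', hε'ε, hε'δ⟩ : ∃ ε' : ℝ, 0 < ε' ∧ ε' ≤ ε ∧ ε' + ε' < δ :=
    ⟨min ε (δ / 3), lt_min hε (by linarith), min_le_left _ _, by
      have := min_le_right ε (δ / 3); linarith⟩
  refine ⟨ε', hε', fun x => ?_⟩
  have hsub : ∀ z ∈ localUnstableSet f ε' x, ∀ w ∈ localStableSet f ε' x,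
      edist z w < ENNReal.ofReal δ := by
    intro z hz w hw
    calc edist z w ≤ edist z x + edist x w := edist_triangle _ _ _
      _ ≤ ENNReal.ofReal ε' + ENNReal.ofReal ε' := by
          rw [edist_comm z]
          exact add_le_add (edist_le_of_mem_localUnstableSet hz) (edist_le_of_mem_localStableSet hw)
      _ = ENNReal.ofReal (ε' + ε') := (ENNReal.ofReal_add hε'.le hε'.le).symm
      _ < ENNReal.ofReal δ := (ENNReal.ofReal_lt_ofReal_iff hδ).2 hε'δ
  have : CompactSpace ↥(localUnstableSet f ε' x) :=
    isCompact_iff_compactSpace.1 (isClosed_localUnstableSet hc ε' x).isCompact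
  have : CompactSpace ↥(localStableSet f ε' x) :=
    isCompact_iff_compactSpace.1 (isClosed_localStableSet hc ε' x).isCompact
  let F : ↥(localUnstableSet f ε' x) × ↥(localStableSet f ε' x) → M := fun p =>
    bracket h ⟨(p.1.1, p.2.1), hsub p.1.1 p.1.2 p.2.1 p.2.2⟩
  have hFm : ∀ p, F p ∈ localStableSet f ε p.1.1 ∩ localUnstableSet f ε p.2.1 :=
    fun p =>
    bracket_mem h ⟨(p.1.1, p.2.1), hsub p.1.1 p.1.2 p.2.1 p.2.2⟩
  have hF : Continuous F := by
    refine (continuous_bracket hc h).comp (Continuous.subtype_mk ?_ _)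
    fun_prop
  -- `z` is the only point of `W^s_ε(F p) ∩ W^u_ε(x)`, and `w` the only point of `W^s_ε(x) ∩ W^u_ε(F
  -- p)`.
  have hinj : Function.Injective F := by
    intro p q hpq
    have h1 := hFm p
    have h2 := hFm q
    rw [← hpq] at h2
    refine Prod.ext (Subtype.ext ?_) (Subtype.ext ?_)
    · exact hρ.eq_of_mem hε hερ (x := F p) (y := x)
        ⟨mem_localStableSet_comm.1 h1.1, localUnstableSet_mono hε'ε _ p.1.2⟩
        ⟨mem_localStableSet_comm.1 h2.1, localUnstableSet_mono hε'ε _ q.1.2⟩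
    · exact hρ.eq_of_mem hε hερ (x := x) (y := F p)
        ⟨localStableSet_mono hε'ε _ p.2.2, mem_localUnstableSet_comm.1 h1.2⟩
        ⟨localStableSet_mono hε'ε _ q.2.2, mem_localUnstableSet_comm.1 h2.2⟩
  have hemb : IsEmbedding F := (hF.isClosedEmbedding hinj).isEmbedding
  refine ⟨hsub, Set.range F, hemb.toHomeomorph, ?_, fun p => rfl⟩
  -- Intersections at the smaller scale `ε'` supply, for every `p` near `x`, the coordinates `z` and
  -- `w` with `p = [z,w]`.
  obtain ⟨η, hη, H⟩ := hI ε' hε'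
  have hev : ∀ᶠ p in 𝓝 x, edist p x < ENNReal.ofReal η := by
    have : Filter.Tendsto (fun p => edist p x) (𝓝 x) (𝓝 (edist x x)) :=
      (continuous_id.edist continuous_const).tendsto x
    rw [edist_self] at this
    exact this.eventually (gt_mem_nhds (ENNReal.ofReal_pos.2 hη))
  filter_upwards [hev] with p hp
  obtain ⟨z, hz1, hz2⟩ := H p x hp
  obtain ⟨w, hw1, hw2⟩ := H x p (by rwa [edist_comm])
  refine ⟨(⟨z, hz2⟩, ⟨w, hw1⟩), ?_⟩
  refine (h z w (hsub z hz2 w hw1)).unique (hFm (⟨z, hz2⟩, ⟨w, hw1⟩)) ⟨?_, ?_⟩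
  · exact mem_localStableSet_comm.1 (localStableSet_mono hε'ε _ hz1)
  · exact mem_localUnstableSet_comm.1 (localUnstableSet_mono hε'ε _ hw2)

end LocalSets

/-! ### Orbits of hyperbolic sequences of maps as fixed points. -/

section HyperbolicSequence

variable {E : Type*} [NormedAddCommGroup E] [NormedSpace ℝ E]

/-- On the ball of radius `η`, the map `G` contracts in the direction of the range of the
projection `P'` and expands, with approximate inverse `R`, in the direction of the kernel of
`P`. -/
structure IsHyperbolicStep (P P' R : E →L[ℝ] E) (G : E → E) (η : ℝ) : Prop where
  idem : ∀ v, P (P v) = P v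
  proj_inv : ∀ v, P (R v) = 0
  ker : ∀ v, R v = 0 → P' v = 0 → v = 0
  norm_inv : ‖R‖ ≤ 1 / 4
  contract : ∀ u v, ‖u‖ ≤ η → ‖v‖ ≤ η → ‖P' (G u - G v)‖ ≤ 1 / 4 * ‖u - v‖
  expand : ∀ u v, ‖u‖ ≤ η → ‖v‖ ≤ η →
    ‖(u - v) - P (u - v) - R (G u - G v)‖ ≤ 1 / 4 * ‖u - v‖

theorem IsHyperbolicStep.mono {P P' R : E →L[ℝ] E} {G : E → E} {η η' : ℝ}
    (h : IsHyperbolicStep P P' R G η) (hη : η' ≤ η) : IsHyperbolicStep P P' R G η' :=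
  { h with
    contract := fun u v hu hv => h.contract u v (hu.trans hη) (hv.trans hη)
    expand := fun u v hu hv => h.expand u v (hu.trans hη) (hv.trans hη) }

variable {P R : ℤ → E →L[ℝ] E} {G : ℤ → E → E} {η : ℝ}

/-- The map on sequences whose fixed points are the orbits of `G`. -/
def orbitMap (P R : ℤ → E →L[ℝ] E) (G : ℤ → E → E) (v : ℤ → E) (n : ℤ) : E :=
  P n (G (n - 1) (v (n - 1))) + (v n - P n (v n)) + R n (v (n + 1) - G n (v n))

/-- Applying `P n` to the fixed-point equation kills the last two terms and shows that the defect `v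
(n + 1) - G n (v n)` is killed by `P (n + 1)`. What remains says that `R n` kills it too, so `ker`
makes it zero. -/
theorem orbitMap_eq_self_iff (h : ∀ n, IsHyperbolicStep (P n) (P (n + 1)) (R n) (G n) η)
    (v : ℤ → E) : orbitMap P R G v = v ↔ ∀ n, v (n + 1) = G n (v n) := by
  constructor
  · intro hv
    have h1 : ∀ n, P n (v n) = P n (G (n - 1) (v (n - 1))) := by
      intro n
      have := congrArg (P n) (congrFun hv n)
      simp only [orbitMap, map_add, (h n).idem, (h n).proj_inv, add_zero] at this
      rw [← this]
      simp [map_sub, (h n).idem]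
    intro n
    rw [← sub_eq_zero]
    refine (h n).ker _ ?_ ?_
    · have := congrFun hv n
      rw [orbitMap, ← h1 n] at this
      simpa using this
    · rw [map_sub, h1 (n + 1), sub_eq_zero]
      simp
  · intro hv
    funext n
    have h1 : v n = G (n - 1) (v (n - 1)) := by simpa using hv (n - 1)
    rw [orbitMap, ← h1, hv n]
    simp

/-- Past, present and future each contribute one quarter, by `contract`, `expand` and `norm_inv`
respectively. -/
theorem norm_orbitMap_sub_le (h : ∀ n, IsHyperbolicStep (P n) (P (n + 1)) (R n) (G n) η)
    {u v : ℤ → E} (hu : ∀ n, ‖u n‖ ≤ η) (hv : ∀ n, ‖v n‖ ≤ η) {d : ℝ}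
    (hd : ∀ n, ‖u n - v n‖ ≤ d) (n : ℤ) :
    ‖orbitMap P R G u n - orbitMap P R G v n‖ ≤ 3 / 4 * d := by
  have e : orbitMap P R G u n - orbitMap P R G v n =
      P n (G (n - 1) (u (n - 1)) - G (n - 1) (v (n - 1)))
      + ((u n - v n) - P n (u n - v n) - R n (G n (u n) - G n (v n)))
      + R n (u (n + 1) - v (n + 1)) := by
    simp only [orbitMap, map_sub]
    abel
  have h1 := (h (n - 1)).contract _ _ (hu (n - 1)) (hv (n - 1))
  rw [sub_add_cancel] at h1
  have h2 := (h n).expand _ _ (hu n) (hv n)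
  have h3 : ‖R n (u (n + 1) - v (n + 1))‖ ≤ 1 / 4 * d :=
    ((R n).le_of_opNorm_le (h n).norm_inv _).trans (by linarith [hd (n + 1)])
  rw [e]
  have := norm_add₃_le (a := P n (G (n - 1) (u (n - 1)) - G (n - 1) (v (n - 1))))
    (b := (u n - v n) - P n (u n - v n) - R n (G n (u n) - G n (v n)))
    (c := R n (u (n + 1) - v (n + 1)))
  linarith [hd n, hd (n - 1)]

/-- A hyperbolic sequence of maps has at most one orbit that stays close to zero. -/
theorem eq_of_hyperbolic_orbits (h : ∀ n, IsHyperbolicStep (P n) (P (n + 1)) (R n) (G n) η)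
    {u v : ℤ → E} (hu : ∀ n, ‖u n‖ ≤ η) (hv : ∀ n, ‖v n‖ ≤ η)
    (hu' : ∀ n, u (n + 1) = G n (u n)) (hv' : ∀ n, v (n + 1) = G n (v n)) : u = v := by
  have key : ∀ k : ℕ, ∀ n, ‖u n - v n‖ ≤ (3 / 4 : ℝ) ^ k * (η + η) := by
    intro k
    induction k with
    | zero =>
      intro n
      simpa using (norm_sub_le _ _).trans (add_le_add (hu n) (hv n))
    | succ k ih =>
      intro n
      have := norm_orbitMap_sub_le h hu hv ih n
      rw [(orbitMap_eq_self_iff h u).2 hu', (orbitMap_eq_self_iff h v).2 hv'] at this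
      rw [pow_succ']
      linarith
  funext n
  have hlim : Filter.Tendsto (fun k : ℕ => (3 / 4 : ℝ) ^ k * (η + η)) Filter.atTop (𝓝 0) := by
    simpa using (tendsto_pow_atTop_nhds_zero_of_lt_one (by norm_num : (0 : ℝ) ≤ 3 / 4)
      (by norm_num)).mul_const (η + η)
  have := ge_of_tendsto' hlim fun k => key k n
  exact sub_eq_zero.1 (norm_le_zero_iff.1 this)

/-- A hyperbolic sequence of maps that almost fix zero has an orbit that stays close to zero. -/
theorem exists_hyperbolic_orbit [CompleteSpace E]
    (h : ∀ n, IsHyperbolicStep (P n) (P (n + 1)) (R n) (G n) η) (hη : 0 ≤ η)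
    (h0 : ∀ n, ‖P (n + 1) (G n 0)‖ + ‖R n (G n 0)‖ ≤ η / 8) :
    ∃ v : ℤ → E, (∀ n, ‖v n‖ ≤ η) ∧ ∀ n, v (n + 1) = G n (v n) := by
  have hzero : ∀ n, ‖orbitMap P R G 0 n‖ ≤ η / 4 := by
    intro n
    have h1 := h0 (n - 1)
    rw [sub_add_cancel] at h1
    have h2 := h0 n
    have : orbitMap P R G 0 n = P n (G (n - 1) 0) - R n (G n 0) := by
      simp [orbitMap, sub_eq_add_neg]
    rw [this]
    have h3 := norm_sub_le (P n (G (n - 1) 0)) (R n (G n 0))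
    linarith [norm_nonneg (R (n - 1) (G (n - 1) 0)), norm_nonneg (P (n + 1) (G n 0))]
  -- The ball is preserved because `3/4 * η + η/4 = η`.
  have hball : ∀ v : ℤ → E, (∀ n, ‖v n‖ ≤ η) → ∀ n, ‖orbitMap P R G v n‖ ≤ η := by
    intro v hv n
    have h1 := norm_orbitMap_sub_le h (v := 0) hv (fun n => by simpa using hη) (d := η)
      (fun n => by simpa using hv n) n
    have h2 := norm_add_le (orbitMap P R G v n - orbitMap P R G 0 n) (orbitMap P R G 0 n)
    rw [sub_add_cancel] at h2
    linarith [hzero n]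
  let B := {v : BoundedContinuousFunction ℤ E // ‖v‖ ≤ η}
  have hB : ∀ v : B, ∀ n, ‖v.1 n‖ ≤ η := fun v n => (v.1.norm_coe_le_norm n).trans v.2
  let T : B → B := fun v =>
    ⟨BoundedContinuousFunction.ofNormedAddCommGroupDiscrete (orbitMap P R G v.1) η
      (hball _ (hB v)), (BoundedContinuousFunction.norm_le hη).2 (hball _ (hB v))⟩
  have hT : ContractingWith (3 / 4) T := by
    refine ⟨by rw [← NNReal.coe_lt_coe]; norm_num, LipschitzWith.of_dist_le_mul fun u v => ?_⟩
    change dist (T u).1 (T v).1 ≤ _ * dist u.1 v.1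
    refine (BoundedContinuousFunction.dist_le (by positivity)).2 fun n => ?_
    rw [dist_eq_norm]
    have := norm_orbitMap_sub_le h (hB u) (hB v) (d := dist u.1 v.1)
      (fun n => by rw [← dist_eq_norm]; exact u.1.dist_coe_le_dist n) n
    have e : ((3 / 4 : NNReal) : ℝ) = 3 / 4 := by norm_num
    rw [e]
    exact this
  have hcl : IsClosed {v : BoundedContinuousFunction ℤ E | ‖v‖ ≤ η} :=
    isClosed_le continuous_norm continuous_const
  have : CompleteSpace B := hcl.completeSpace_coe
  have : Nonempty B := ⟨⟨0, by simpa using hη⟩⟩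
  let v : B := ContractingWith.fixedPoint T hT
  have hv : T v = v := hT.fixedPoint_isFixedPt
  refine ⟨v.1, hB v, (orbitMap_eq_self_iff h v.1).1 ?_⟩
  have : ⇑(T v).1 = ⇑v.1 := by rw [hv]
  exact this

end HyperbolicSequence

/-! ### From local to uniform scales on compact sets. -/

section Uniform

/-- A property of points and scales that holds locally uniformly on a compact set holds
uniformly at all small scales. -/
theorem IsCompact.eventually_forall_of_local {X : Type*} [TopologicalSpace X] {K : Set X}
    (hK : IsCompact K) {Q : X → ℝ → Prop} (hQ : ∀ x r r', r' ≤ r → Q x r → Q x r')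
    (hloc : ∀ x ∈ K, ∃ r : ℝ, 0 < r ∧ ∀ᶠ y in 𝓝 x, y ∈ K → Q y r) :
    ∀ᶠ r in 𝓝[>] (0 : ℝ), ∀ x ∈ K, Q x r := by
  refine hK.induction_on (p := fun s => ∀ᶠ r in 𝓝[>] (0 : ℝ), ∀ x ∈ s, Q x r) ?_ ?_ ?_ ?_
  · simp
  · exact fun s t hst h => h.mono fun r hr x hx => hr x (hst hx)
  · intro s t hs ht
    filter_upwards [hs, ht] with r h1 h2 x hx
    exact hx.elim (h1 x) (h2 x)
  · intro x hx
    obtain ⟨r, hr, h⟩ := hloc x hx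
    refine ⟨{y | y ∈ K → Q y r} ∩ K, Filter.inter_mem (mem_nhdsWithin_of_mem_nhds h)
      self_mem_nhdsWithin, ?_⟩
    filter_upwards [Ioc_mem_nhdsGT hr] with r' hr' y hy
    exact hQ y r r' hr'.2 (hy.1 hy.2)

/-- Halving the radius of a ball about `g x` leaves room for `g y` to move. That radius may be `⊤`,
hence the case split. -/
theorem ContinuousAt.exists_eventually_edist_lt {X Y : Type*} [TopologicalSpace X]
    [PseudoEMetricSpace Y] {g : X → Y} {x : X} (hg : ContinuousAt g x) {V : Set Y}
    (hV : V ∈ 𝓝 (g x)) :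
    ∃ r : ℝ, 0 < r ∧ ∀ᶠ y in 𝓝 x, ∀ z, edist (g y) z < ENNReal.ofReal r → z ∈ V := by
  obtain ⟨δ, hδ, hδV⟩ := EMetric.mem_nhds_iff.1 hV
  obtain ⟨r, hr, hrδ⟩ : ∃ r : ℝ, 0 < r ∧ ENNReal.ofReal r ≤ δ / 2 := by
    rcases eq_or_ne δ ⊤ with rfl | h
    · exact ⟨1, one_pos, by simp [ENNReal.top_div]⟩
    · refine ⟨(δ / 2).toReal, ENNReal.toReal_pos ?_ ?_, ?_⟩
      · simpa using hδ.ne'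
      · exact (ENNReal.div_lt_top h (by simp)).ne
      · exact ENNReal.ofReal_toReal_le
  refine ⟨r, hr, ?_⟩
  have hev := hg (Metric.eball_mem_nhds (g x) (ENNReal.half_pos hδ.ne'))
  filter_upwards [hev] with y hy z hz
  refine hδV ?_
  have hy' : edist (g y) (g x) < δ / 2 := hy
  change edist z (g x) < δ
  calc edist z (g x) ≤ edist z (g y) + edist (g y) (g x) := edist_triangle _ _ _
    _ < δ / 2 + δ / 2 := ENNReal.add_lt_add (by rw [edist_comm]; exact hz.trans_le hrδ) hy'
    _ = δ := ENNReal.add_halves δ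

end Uniform

theorem exists_isExpansivityConstant_of_pow {M : Type*} [EMetricSpace M] {f : Equiv.Perm M} {N : ℕ}
    (h : ∃ ρ : ℝ, 0 < ρ ∧ ∀ x y : M,
      (∀ n : ℤ, edist (((f ^ N) ^ n) x) (((f ^ N) ^ n) y) ≤ ENNReal.ofReal ρ) → x = y) :
    ∃ ρ : ℝ, IsExpansivityConstant f ρ := by
  obtain ⟨ρ, hρ, H⟩ := h
  refine ⟨ρ, hρ, fun x y => ⟨fun hxy => H x y fun n => ?_, ?_⟩⟩
  · rw [← zpow_natCast, ← zpow_mul]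
    exact hxy _
  · rintro rfl n
    simp

/-! ### Expansivity and shadowing from a hyperbolic atlas. -/

section Atlas

variable {E : Type*} [NormedAddCommGroup E] [NormedSpace ℝ E] {M : Type*} [EMetricSpace M]

/-- A finite family of charts, with projections of the model space attached to the points of
the charts, in which all local representatives of `g` are uniformly hyperbolic. -/
structure IsHyperbolicAtlas {ι : Type*} (g : M → M) (κ : ι → OpenPartialHomeomorph M E)
    (C : ι → Set M) (P : ι → M → E →L[ℝ] E) : Prop where
  isClosed : ∀ i, IsClosed (C i)
  subset : ∀ i, C i ⊆ (κ i).source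
  cover : ∀ x, ∃ i, x ∈ C i
  bounded : ∃ B : ℝ, ∀ i, ∀ x ∈ C i, ‖P i x‖ ≤ B
  step : ∀ i j, ∀ x ∈ C i, g x ∈ C j → ∃ η : ℝ, 0 < η ∧ ∃ V ∈ 𝓝 (g x), ∀ᶠ y in 𝓝 x, ∀ y' ∈ V,
    (∀ v, ‖v‖ ≤ η → κ i y + v ∈ (κ i).target ∧ g ((κ i).symm (κ i y + v)) ∈ (κ j).source) ∧
    ∃ R, IsHyperbolicStep (P i y) (P j y') R
      (fun v => κ j (g ((κ i).symm (κ i y + v))) - κ j y') η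

variable {ι : Type*} [Finite ι] [CompactSpace M] {κ : ι → OpenPartialHomeomorph M E}
  {C : ι → Set M} {P : ι → M → E →L[ℝ] E} {g : Equiv.Perm M}

namespace IsHyperbolicAtlas

/-- Compactness of `C i` makes the scale in `step` uniform. The target `x'` need only be close to `g
x`, which is what pseudo-orbits require; if `g x ∉ C j`, closedness of `C j` makes the claim vacuous
nearby. -/
theorem eventually_step (h : IsHyperbolicAtlas g κ C P) (hg : Continuous g) :
    ∀ᶠ r in 𝓝[>] (0 : ℝ), ∀ i j, ∀ x ∈ C i, ∀ x' ∈ C j, edist (g x) x' < ENNReal.ofReal r →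
      (∀ v, ‖v‖ ≤ r → κ i x + v ∈ (κ i).target ∧
        g ((κ i).symm (κ i x + v)) ∈ (κ j).source) ∧
      ∃ R, IsHyperbolicStep (P i x) (P j x') R
        (fun v => κ j (g ((κ i).symm (κ i x + v))) - κ j x') r := by
  refine Filter.eventually_all.2 fun i => Filter.eventually_all.2 fun j => ?_
  refine (h.isClosed i).isCompact.eventually_forall_of_local ?_ ?_
  · intro x r r' hr H x' hx' hxx'
    obtain ⟨h1, R, h2⟩ := H x' hx' (hxx'.trans_le (ENNReal.ofReal_le_ofReal hr))
    exact ⟨fun v hv => h1 v (hv.trans hr), R, h2.mono hr⟩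
  · intro x hx
    by_cases hgx : g x ∈ C j
    · obtain ⟨η, hη, V, hV, H⟩ := h.step i j x hx hgx
      obtain ⟨r, hr, hr'⟩ := hg.continuousAt.exists_eventually_edist_lt hV
      refine ⟨min η r, lt_min hη hr, ?_⟩
      filter_upwards [H, hr'] with y h1 h2 _ x' _ hyx'
      obtain ⟨h3, R, h4⟩ := h1 x'
        (h2 x' (hyx'.trans_le (ENNReal.ofReal_le_ofReal (min_le_right _ _))))
      exact ⟨fun v hv => h3 v (hv.trans (min_le_left _ _)), R, h4.mono (min_le_left _ _)⟩
    · obtain ⟨r, hr, hr'⟩ := hg.continuousAt.exists_eventually_edist_lt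
        ((h.isClosed j).isOpen_compl.mem_nhds hgx)
      refine ⟨r, hr, ?_⟩
      filter_upwards [hr'] with y h1 _ x' hx' hyx'
      exact absurd hx' (h1 x' hyx')

theorem eventually_edist_symm_le (h : IsHyperbolicAtlas g κ C P) {ε : ℝ} (hε : 0 < ε) :
    ∀ᶠ r in 𝓝[>] (0 : ℝ), ∀ i, ∀ x ∈ C i, ∀ v, ‖v‖ ≤ r →
      edist x ((κ i).symm (κ i x + v)) ≤ ENNReal.ofReal ε := by
  refine Filter.eventually_all.2 fun i => ?_
  refine (h.isClosed i).isCompact.eventually_forall_of_local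
    (fun x r r' hr H v hv => H v (hv.trans hr)) fun x hx => ?_
  have hxs := h.subset i hx
  have hc : ContinuousAt (fun q : M × E => edist q.1 ((κ i).symm (κ i q.1 + q.2))) (x, 0) := by
    have h1 : ContinuousAt (fun q : M × E => κ i q.1 + q.2) (x, 0) :=
      (((κ i).continuousAt hxs).comp continuousAt_fst).add continuousAt_snd
    have h2 : ContinuousAt (κ i).symm (κ i x + 0) := by
      rw [add_zero]; exact (κ i).continuousAt_symm ((κ i).map_source hxs)
    exact Filter.Tendsto.edist continuousAt_fst
      (ContinuousAt.comp (g := (κ i).symm) (f := fun q : M × E => κ i q.1 + q.2) h2 h1)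
  have h0 : edist x ((κ i).symm (κ i x + 0)) < ENNReal.ofReal ε := by
    rw [add_zero, (κ i).left_inv hxs, edist_self]
    exact ENNReal.ofReal_pos.2 hε
  have hev := hc.eventually (gt_mem_nhds h0)
  rw [nhds_prod_eq] at hev
  obtain ⟨pa, ha, pb, hb, hab⟩ := Filter.eventually_prod_iff.1 hev
  obtain ⟨r, hr, hrb⟩ := Metric.nhds_basis_closedBall.eventually_iff.1 hb
  refine ⟨r, hr, ?_⟩
  filter_upwards [ha] with y hy _ v hv
  exact (hab hy (hrb (by simpa using hv))).le

theorem eventually_norm_sub_le (h : IsHyperbolicAtlas g κ C P) {ε : ℝ} (hε : 0 < ε) :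
    ∀ᶠ r in 𝓝[>] (0 : ℝ), ∀ i, ∀ x ∈ C i, ∀ y, edist x y < ENNReal.ofReal r →
      y ∈ (κ i).source ∧ ‖κ i y - κ i x‖ ≤ ε := by
  refine Filter.eventually_all.2 fun i => ?_
  refine (h.isClosed i).isCompact.eventually_forall_of_local
    (fun x r r' hr H y hy => H y (hy.trans_le (ENNReal.ofReal_le_ofReal hr))) fun x hx => ?_
  have hxs := h.subset i hx
  have hball := (κ i).continuousAt hxs (Metric.ball_mem_nhds (κ i x) (half_pos hε))
  obtain ⟨r, hr, hr'⟩ := continuousAt_id.exists_eventually_edist_lt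
    (Filter.inter_mem ((κ i).open_source.mem_nhds hxs) hball)
  refine ⟨r, hr, ?_⟩
  filter_upwards [hr', hball] with y hy hyb _ z hz
  obtain ⟨h1, h2⟩ := hy z hz
  refine ⟨h1, ?_⟩
  have h3 : dist (κ i z) (κ i x) < ε / 2 := h2
  have h4 : dist (κ i y) (κ i x) < ε / 2 := hyb
  rw [← dist_eq_norm]
  linarith [dist_triangle_right (κ i z) (κ i y) (κ i x)]

theorem exists_expansive (h : IsHyperbolicAtlas g κ C P) (hg : Continuous g) :
    ∃ ρ : ℝ, 0 < ρ ∧ ∀ x y : M,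
      (∀ n : ℤ, edist ((g ^ n) x) ((g ^ n) y) ≤ ENNReal.ofReal ρ) → x = y := by
  obtain ⟨η, hη, hη0⟩ := ((h.eventually_step hg).and self_mem_nhdsWithin).exists
  have hη0 : 0 < η := hη0
  obtain ⟨r, hr, hr0⟩ := ((h.eventually_norm_sub_le hη0).and self_mem_nhdsWithin).exists
  have hr0 : 0 < r := hr0
  refine ⟨r / 2, half_pos hr0, fun x y hxy => ?_⟩
  choose c hc using fun n : ℤ => h.cover ((g ^ n) x)
  have hsucc : ∀ (n : ℤ) (z : M), g ((g ^ n) z) = (g ^ (n + 1)) z := fun n z => by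
    rw [add_comm, zpow_add, zpow_one, Equiv.Perm.mul_apply]
  have hstep := fun n : ℤ => (hη (c n) (c (n + 1)) _ (hc n) _ (hc (n + 1))
    (by rw [hsucc, edist_self]; exact ENNReal.ofReal_pos.2 hη0)).2
  choose R hR using hstep
  have hclose := fun n : ℤ => hr (c n) _ (hc n) ((g ^ n) y)
    ((hxy n).trans_lt ((ENNReal.ofReal_lt_ofReal_iff hr0).2 (half_lt_self hr0)))
  -- In coordinates centred on the orbit of `x`, that orbit is the zero sequence and the orbit of
  -- `y` is a second small orbit.
  have heq := eq_of_hyperbolic_orbits (P := fun n => P (c n) ((g ^ n) x)) (R := R)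
    hR (u := fun _ => 0) (v := fun n => κ (c n) ((g ^ n) y) - κ (c n) ((g ^ n) x))
    (fun n => by simpa using hη0.le) (fun n => (hclose n).2)
    (fun n => by
      rw [add_zero, (κ (c n)).left_inv (h.subset _ (hc n)), hsucc, sub_self])
    (fun n => by
      rw [add_sub_cancel, (κ (c n)).left_inv (hclose n).1, hsucc])
  have h0 := congrFun heq 0
  have h1 : κ (c 0) y = κ (c 0) x := by
    simpa [sub_eq_zero] using h0.symm
  have h2 := h.subset _ (hc 0)
  have h3 := (hclose 0).1
  simp only [zpow_zero, Equiv.Perm.coe_one, id_eq] at h2 h3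
  exact ((κ (c 0)).injOn h3 h2 h1).symm

theorem exists_shadowing [CompleteSpace E] (h : IsHyperbolicAtlas g κ C P) (hg : Continuous g)
    {ε : ℝ} (hε : 0 < ε) : ∃ δ : ℝ, 0 < δ ∧ ∀ x : ℤ → M,
      (∀ n, edist (g (x n)) (x (n + 1)) < ENNReal.ofReal δ) →
      ∃ z, ∀ n : ℤ, edist (x n) ((g ^ n) z) ≤ ENNReal.ofReal ε := by
  obtain ⟨η, ⟨hη, hηε⟩, hη0⟩ :=
    (((h.eventually_step hg).and (h.eventually_edist_symm_le hε)).and self_mem_nhdsWithin).exists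
  have hη0 : 0 < η := hη0
  obtain ⟨B, hB⟩ := h.bounded
  have hB' : ∀ i, ∀ x ∈ C i, ‖P i x‖ ≤ |B| := fun i x hx => (hB i x hx).trans (le_abs_self B)
  -- A jump of this size costs at most `|B|` times itself through `P` and a quarter of itself
  -- through `R`, in total at most `η / 8`.
  obtain ⟨r, hr, hr0⟩ := ((h.eventually_norm_sub_le
    (show 0 < η / (8 * (|B| + 1)) by positivity)).and self_mem_nhdsWithin).exists
  have hr0 : 0 < r := hr0
  refine ⟨min η r, lt_min hη0 hr0, fun x hx => ?_⟩
  choose c hc using fun n : ℤ => h.cover (x n)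
  have hstep := fun n : ℤ => hη (c n) (c (n + 1)) _ (hc n) _ (hc (n + 1))
    ((hx n).trans_le (ENNReal.ofReal_le_ofReal (min_le_left _ _)))
  choose hdom R hR using hstep
  have hclose := fun n : ℤ => (hr (c (n + 1)) _ (hc (n + 1)) (g (x n))
    (by rw [edist_comm]
        exact (hx n).trans_le (ENNReal.ofReal_le_ofReal (min_le_right _ _)))).2
  obtain ⟨v, hv, hv'⟩ := exists_hyperbolic_orbit (P := fun n => P (c n) (x n)) (R := R) hR hη0.le
    (fun n => by
      rw [add_zero, (κ (c n)).left_inv (h.subset _ (hc n))]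
      have h1 := ((P (c (n + 1)) (x (n + 1))).le_of_opNorm_le (hB' _ _ (hc (n + 1)))
        (κ (c (n + 1)) (g (x n)) - κ (c (n + 1)) (x (n + 1))))
      have h2 := ((R n).le_of_opNorm_le (hR n).norm_inv
        (κ (c (n + 1)) (g (x n)) - κ (c (n + 1)) (x (n + 1))))
      have h3 := hclose n
      rw [le_div_iff₀ (by positivity)] at h3
      have h4 := norm_nonneg (κ (c (n + 1)) (g (x n)) - κ (c (n + 1)) (x (n + 1)))
      linarith)
  let p : ℤ → M := fun n => (κ (c n)).symm (κ (c n) (x n) + v n)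
  have hp : ∀ n, p (n + 1) = g (p n) := by
    intro n
    change (κ (c (n + 1))).symm (κ (c (n + 1)) (x (n + 1)) + v (n + 1)) = _
    rw [hv' n, add_sub_cancel]
    exact (κ (c (n + 1))).left_inv (hdom n _ (hv n)).2
  have hpn : ∀ n : ℤ, p n = (g ^ n) (p 0) := by
    intro n
    induction n with
    | zero => simp
    | succ n ih => rw [hp, ih, add_comm (n : ℤ), zpow_add, zpow_one, Equiv.Perm.mul_apply]
    | pred n ih =>
      apply g.injective
      rw [← hp, sub_add_cancel, ih, ← Equiv.Perm.mul_apply, ← zpow_one_add, add_sub_cancel]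
  exact ⟨p 0, fun n => by rw [← hpn]; exact hηε _ _ (hc n) _ (hv n)⟩

theorem hasLocalIntersections [CompleteSpace E] (h : IsHyperbolicAtlas g κ C P)
    (hg : Continuous g) : HasLocalIntersections g := by
  intro ε hε
  obtain ⟨δ, hδ, H⟩ := h.exists_shadowing hg (half_pos hε)
  refine ⟨min δ (ε / 2), lt_min hδ (half_pos hε), fun x y hxy => ?_⟩
  -- The only jump is from time `-1` to time `0`, where `y` is replaced by `x`.
  obtain ⟨z, hz⟩ := H (fun n => if 0 ≤ n then (g ^ n) x else (g ^ n) y) (fun n => by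
    have hsucc : ∀ z : M, g ((g ^ n) z) = (g ^ (n + 1)) z := fun z => by
      rw [add_comm, zpow_add, zpow_one, Equiv.Perm.mul_apply]
    rcases lt_trichotomy n (-1) with hn | rfl | hn
    · rw [if_neg (by omega), if_neg (by omega), hsucc, edist_self]
      exact ENNReal.ofReal_pos.2 hδ
    · rw [if_neg (by omega), if_pos (by omega), hsucc, edist_comm]
      simpa using hxy.trans_le (ENNReal.ofReal_le_ofReal (min_le_left _ _))
    · rw [if_pos (by omega), if_pos (by omega), hsucc, edist_self]
      exact ENNReal.ofReal_pos.2 hδ)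
  have hle : ENNReal.ofReal (ε / 2) ≤ ENNReal.ofReal ε :=
    ENNReal.ofReal_le_ofReal (half_le_self hε.le)
  refine ⟨z, fun n hn => ?_, fun n hn => ?_⟩
  · have := hz n
    rw [if_pos hn] at this
    exact this.trans hle
  · rcases hn.lt_or_eq with hn | rfl
    · have := hz n
      rw [if_neg (by omega)] at this
      exact this.trans hle
    -- At time `0` the pseudo-orbit sits at `x`, so the distance from `z` to `y` also pays for
    -- `edist x y`; hence the two halves of `ε`.
    · have := hz 0
      simp only [le_refl, if_true, zpow_zero, Equiv.Perm.coe_one, id_eq] at this ⊢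
      calc edist y z ≤ edist y x + edist x z := edist_triangle _ _ _
        _ ≤ ENNReal.ofReal (ε / 2) + ENNReal.ofReal (ε / 2) := by
            refine add_le_add ?_ this
            rw [edist_comm]
            exact hxy.le.trans (ENNReal.ofReal_le_ofReal (min_le_right _ _))
        _ = ENNReal.ofReal ε := by
            rw [← ENNReal.ofReal_add (by positivity) (by positivity), add_halves]

end IsHyperbolicAtlas

/-- Write `n = N * (n / N) + n % N`. Floor division preserves both `0 ≤ n` and `n ≤ 0`, and the
remainder costs one of finitely many uniformly continuous iterates. -/
theorem hasLocalIntersections_of_pow {f : Equiv.Perm M} (hc : ∀ n : ℤ, Continuous (f ^ n)) {N : ℕ}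
    (hN : 0 < N) (h : HasLocalIntersections (f ^ N)) : HasLocalIntersections f := by
  intro ε hε
  have hunif : ∀ᶠ r in 𝓝[>] (0 : ℝ), ∀ k : Fin N, ∀ x y : M, edist x y ≤ ENNReal.ofReal r →
      edist ((f ^ (k : ℤ)) x) ((f ^ (k : ℤ)) y) ≤ ENNReal.ofReal ε := by
    refine Filter.eventually_all.2 fun k => ?_
    obtain ⟨δ, hδ, H⟩ := EMetric.uniformContinuous_iff.1
      (CompactSpace.uniformContinuous_of_continuous (hc k)) (ENNReal.ofReal ε)
      (ENNReal.ofReal_pos.2 hε)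
    have hlim : Filter.Tendsto ENNReal.ofReal (𝓝[>] (0 : ℝ)) (𝓝 0) := by
      simpa using (ENNReal.continuous_ofReal.tendsto (0 : ℝ)).mono_left nhdsWithin_le_nhds
    filter_upwards [hlim.eventually (gt_mem_nhds hδ)] with r hr x y hxy
    exact (H (hxy.trans_lt hr)).le
  obtain ⟨r, hr, hr0⟩ := (hunif.and self_mem_nhdsWithin).exists
  obtain ⟨δ, hδ, H⟩ := h r hr0
  have hN' : (0 : ℤ) < N := by exact_mod_cast hN
  have key : ∀ (n : ℤ) (x z : M), edist (((f ^ N) ^ (n / N)) x) (((f ^ N) ^ (n / N)) z) ≤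
      ENNReal.ofReal r → edist ((f ^ n) x) ((f ^ n) z) ≤ ENNReal.ofReal ε := by
    intro n x z hxz
    have h1 : ∀ w : M, (f ^ n) w = (f ^ (n % N)) (((f ^ N) ^ (n / N)) w) := by
      intro w
      rw [← zpow_natCast, ← zpow_mul, ← Equiv.Perm.mul_apply, ← zpow_add, Int.emod_add_mul_ediv]
    have h2 := Int.emod_nonneg n hN'.ne'
    have h3 := Int.emod_lt_of_pos n hN'
    have h4 := hr ⟨(n % N).toNat, by omega⟩ _ _ hxz
    simp only [Int.toNat_of_nonneg h2] at h4
    rwa [h1, h1]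
  refine ⟨δ, hδ, fun x y hxy => ?_⟩
  obtain ⟨z, hz1, hz2⟩ := H x y hxy
  exact ⟨z, fun n hn => key n x z (hz1 _ (Int.ediv_nonneg hn hN'.le)),
    fun n hn => key n y z (hz2 _ (by
      rcases hn.lt_or_eq with hn | rfl
      · exact (Int.ediv_neg_of_neg_of_pos hn hN').le
      · simp))⟩

end Atlas

/-! ### Linear hyperbolicity and its stability under perturbation. -/

section LinearHyperbolic

variable {E : Type*} [NormedAddCommGroup E] [NormedSpace ℝ E]

/-- An injective linear map intertwining two projections and expanding the kernels has a partial
inverse on the kernels. -/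
theorem exists_partial_inverse [FiniteDimensional ℝ E] {A P P' : E →L[ℝ] E}
    (hA : Function.Injective A) (hP' : ∀ v, P' (P' v) = P' v) (hAP : ∀ v, A (P v) = P' (A v))
    {q B : ℝ} (hq : 0 ≤ q) (hexp : ∀ v, P v = 0 → ‖v‖ ≤ q * ‖A v‖) (hB : ‖P'‖ ≤ B) :
    ∃ R : E →L[ℝ] E, (∀ v, P (R v) = 0) ∧ (∀ v, R (A v) = v - P v) ∧
      (∀ v, R v = 0 → P' v = v) ∧ ‖R‖ ≤ q * (1 + B) := by
  let A' : E ≃ₗ[ℝ] E := LinearEquiv.ofInjectiveEndo A.toLinearMap hA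
  have hA' : ∀ v, A (A'.symm v) = v := fun v =>
    LinearEquiv.apply_symm_apply A' v
  have hA'2 : ∀ v, A'.symm (A v) = v := fun v =>
    LinearEquiv.symm_apply_apply A' v
  -- `R` is the inverse of `A` after projection along `P'`; it lands in the kernel of `P` because
  -- `A` intertwines the projections.
  let R : E →L[ℝ] E := A'.symm.toLinearMap.toContinuousLinearMap ∘L
    (ContinuousLinearMap.id ℝ E - P')
  have hR : ∀ v, R v = A'.symm (v - P' v) := fun v => rfl
  have hAR : ∀ v, A (R v) = v - P' v := fun v => by rw [hR, hA']
  have hPR : ∀ v, P (R v) = 0 := fun v => hA (by rw [hAP, hAR, map_sub, hP', sub_self, map_zero])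
  refine ⟨R, hPR, fun v => hA (by rw [hAR, map_sub, hAP]), fun v hv => ?_, ?_⟩
  · have := hAR v
    rw [hv, map_zero] at this
    exact (sub_eq_zero.1 this.symm).symm
  · have hB0 : 0 ≤ B := (norm_nonneg _).trans hB
    refine ContinuousLinearMap.opNorm_le_bound _ (by positivity) fun v => ?_
    have h1 := hexp _ (hPR v)
    rw [hAR] at h1
    refine h1.trans ?_
    rw [mul_assoc]
    refine mul_le_mul_of_nonneg_left ?_ hq
    have h2 := norm_sub_le v (P' v)
    have h3 := P'.le_of_opNorm_le hB v
    linarith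

/-- Hyperbolicity of the derivative at a point gives hyperbolic steps at all nearby points. -/
theorem eventually_isHyperbolicStep {X Y : Type*} [TopologicalSpace X] [TopologicalSpace Y]
    {x₀ : X} {y₀ : Y} {P : X → E →L[ℝ] E} {P' : Y → E →L[ℝ] E} {κ : X → E} {κ' : Y → E}
    {h : E → E} {A R : E →L[ℝ] E}
    (hκ : ContinuousAt κ x₀) (hP : ContinuousAt P x₀) (hP' : ContinuousAt P' y₀)
    (hh : HasStrictFDerivAt h A (κ x₀)) (hidem : ∀ᶠ x in 𝓝 x₀, ∀ v, P x (P x v) = P x v)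
    (hPR : ∀ v, P x₀ (R v) = 0) (hRA : ∀ v, R (A v) = v - P x₀ v)
    (hker : ∀ v, R v = 0 → P' y₀ v = v) (hR : ‖R‖ < 1 / 4) (hPA : ‖P' y₀ ∘L A‖ < 1 / 4) :
    ∃ η : ℝ, 0 < η ∧ ∃ V ∈ 𝓝 y₀, ∀ᶠ x in 𝓝 x₀, ∀ y ∈ V, ∃ R', IsHyperbolicStep (P x) (P' y) R'
      (fun v => h (κ x + v) - κ' y) η := by
  have hc : ∀ᶠ c in 𝓝[>] (0 : ℝ), ‖P' y₀ ∘L A‖ + c * ‖P' y₀‖ < 1 / 4 ∧ c * ‖R‖ < 1 / 4 := by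
    refine nhdsWithin_le_nhds (Filter.Eventually.and ?_ ?_)
    · have : ContinuousAt (fun c : ℝ => ‖P' y₀ ∘L A‖ + c * ‖P' y₀‖) 0 := by fun_prop
      exact this.eventually (gt_mem_nhds (by simpa using hPA))
    · have : ContinuousAt (fun c : ℝ => c * ‖R‖) 0 := by fun_prop
      exact this.eventually (gt_mem_nhds (by norm_num))
  obtain ⟨c, ⟨hc1, hc2⟩, hc0⟩ := (hc.and self_mem_nhdsWithin).exists
  have hc0 : 0 < c := hc0
  obtain ⟨s, hs, hsc⟩ : ∃ s ∈ 𝓝 (κ x₀), ∀ p ∈ s, ∀ q ∈ s, ‖h p - h q - A (p - q)‖ ≤ c * ‖p - q‖ := by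
    obtain ⟨s, hs, H⟩ := hh.approximates_deriv_on_nhds (c := ⟨c, hc0.le⟩) (Or.inr hc0)
    exact ⟨s, hs, fun p hp q hq => H p hp q hq⟩
  obtain ⟨r, hr, hrs⟩ := Metric.mem_nhds_iff.1 hs
  have hV : ∀ᶠ y in 𝓝 y₀, ‖P' y ∘L A‖ + c * ‖P' y‖ < 1 / 4 ∧ ‖P' y₀ - P' y‖ < 1 := by
    refine Filter.Eventually.and ?_ ?_
    · have : ContinuousAt (fun y => ‖P' y ∘L A‖ + c * ‖P' y‖) y₀ :=
        (hP'.clm_comp continuousAt_const).norm.add (continuousAt_const.mul hP'.norm)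
      exact this.eventually (gt_mem_nhds hc1)
    · have : ContinuousAt (fun y => ‖P' y₀ - P' y‖) y₀ := (continuousAt_const.sub hP').norm
      exact this.eventually (gt_mem_nhds (by simp))
  -- `R` is corrected to `R - P x ∘L R` so that `P x` kills its range exactly; the other
  -- requirements are strict inequalities at `x₀`, `y₀` and persist.
  have hRc : ContinuousAt (fun x => R - P x ∘L R) x₀ :=
    continuousAt_const.sub (hP.clm_comp continuousAt_const)
  have hR0 : R - P x₀ ∘L R = R := by ext v; simp [hPR]
  have hU1 : ∀ᶠ x in 𝓝 x₀, ‖R - P x ∘L R‖ < 1 / 4 :=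
    hRc.norm.eventually (gt_mem_nhds (by simpa only [hR0] using hR))
  have hU2 : ∀ᶠ x in 𝓝 x₀, ‖ContinuousLinearMap.id ℝ E - P x - (R - P x ∘L R) ∘L A‖ +
      c * ‖R - P x ∘L R‖ < 1 / 4 := by
    have : ContinuousAt (fun x => ‖ContinuousLinearMap.id ℝ E - P x - (R - P x ∘L R) ∘L A‖ +
        c * ‖R - P x ∘L R‖) x₀ :=
      ((continuousAt_const.sub hP).sub (hRc.clm_comp continuousAt_const)).norm.add
        (continuousAt_const.mul hRc.norm)
    refine this.eventually (gt_mem_nhds ?_)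
    have h0 : ContinuousLinearMap.id ℝ E - P x₀ - R ∘L A = 0 := by ext v; simp [hRA]
    simpa only [hR0, h0, norm_zero, zero_add] using hc2
  have hU3 : ∀ᶠ x in 𝓝 x₀, ‖P x - P x₀‖ < 1 := by
    have : ContinuousAt (fun x => ‖P x - P x₀‖) x₀ := (hP.sub continuousAt_const).norm
    exact this.eventually (gt_mem_nhds (by simp))
  have hU4 : ∀ᶠ x in 𝓝 x₀, dist (κ x) (κ x₀) < r / 2 :=
    hκ (Metric.ball_mem_nhds _ (half_pos hr))
  refine ⟨r / 3, by positivity, _, hV, ?_⟩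
  -- Used twice for `ker`: first `R v` is fixed by `P x - P x₀`, then `v` is fixed by `P' y₀ - P'
  -- y`.
  have hzero : ∀ (T : E →L[ℝ] E) (w : E), ‖T‖ < 1 → w = T w → w = 0 := by
    intro T w hT hw
    by_contra hne
    have h1 := T.le_opNorm w
    rw [← hw] at h1
    have h2 : 0 < ‖w‖ := norm_pos_iff.2 hne
    nlinarith
  filter_upwards [hU1, hU2, hU3, hU4, hidem] with x h1 h2 h3 h4 h5 y ⟨hy1, hy2⟩
  have hmem : ∀ v, ‖v‖ ≤ r / 3 → κ x + v ∈ s := fun v hv => hrs (by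
    rw [Metric.mem_ball]
    have e1 := dist_triangle (κ x + v) (κ x) (κ x₀)
    rw [dist_self_add_left] at e1
    linarith)
  have herr : ∀ u v, ‖u‖ ≤ r / 3 → ‖v‖ ≤ r / 3 →
      ‖h (κ x + u) - h (κ x + v) - A (u - v)‖ ≤ c * ‖u - v‖ := by
    intro u v hu hv
    simpa using hsc _ (hmem u hu) _ (hmem v hv)
  refine ⟨R - P x ∘L R, h5, fun v => by simp [h5], fun v hv hv' => ?_, h1.le, ?_, ?_⟩
  · have hRv : R v = 0 := by
      refine hzero (P x - P x₀) _ h3 ?_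
      have : R v = P x (R v) := by simpa [sub_eq_zero] using hv
      simp [hPR, ← this]
    exact hzero (P' y₀ - P' y) v hy2 (by simp [hker v hRv, hv'])
  · intro u v hu hv
    have e : P' y (h (κ x + u) - κ' y - (h (κ x + v) - κ' y)) = (P' y ∘L A) (u - v) +
        P' y (h (κ x + u) - h (κ x + v) - A (u - v)) := by
      simp only [ContinuousLinearMap.comp_apply, map_sub]
      abel
    rw [e]
    have h6 := (P' y ∘L A).le_opNorm (u - v)
    have h7 := (P' y).le_opNorm_of_le (herr u v hu hv)
    have h8 := mul_le_mul_of_nonneg_right hy1.le (norm_nonneg (u - v))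
    refine (norm_add_le _ _).trans ?_
    linarith
  · intro u v hu hv
    have e : (u - v) - P x (u - v) - (R - P x ∘L R) (h (κ x + u) - κ' y - (h (κ x + v) - κ' y)) =
        (ContinuousLinearMap.id ℝ E - P x - (R - P x ∘L R) ∘L A) (u - v) -
        (R - P x ∘L R) (h (κ x + u) - h (κ x + v) - A (u - v)) := by
      simp only [ContinuousLinearMap.comp_apply, sub_apply, map_sub,
        ContinuousLinearMap.id_apply]
      abel
    rw [e]
    have h6 := (ContinuousLinearMap.id ℝ E - P x - (R - P x ∘L R) ∘L A).le_opNorm (u - v)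
    have h7 := (R - P x ∘L R).le_opNorm_of_le (herr u v hu hv)
    have h8 := mul_le_mul_of_nonneg_right h2.le (norm_nonneg (u - v))
    refine (norm_sub_le _ _).trans ?_
    linarith

end LinearHyperbolic

/-! ### Derivatives of chart representatives. -/

section Chart

variable {E : Type*} [NormedAddCommGroup E] [NormedSpace ℝ E]
  {M : Type*} [TopologicalSpace M] [ChartedSpace E M] [IsManifold 𝓘(ℝ, E) 1 M]

theorem hasStrictFDerivAt_chart_rep {g : M → M} (hg : ContMDiff 𝓘(ℝ, E) 𝓘(ℝ, E) 1 g) {a b x : M}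
    (hx : x ∈ (chartAt E a).source) (hgx : g x ∈ (chartAt E b).source) :
    HasStrictFDerivAt (fun p => chartAt E b (g ((chartAt E a).symm p)))
      ((trivializationAt E (TangentSpace 𝓘(ℝ, E)) b).continuousLinearMapAt ℝ (g x) ∘L
        mfderiv 𝓘(ℝ, E) 𝓘(ℝ, E) g x ∘L
        (trivializationAt E (TangentSpace 𝓘(ℝ, E)) a).symmL ℝ x) (chartAt E a x) := by
  have hc : ContDiffAt ℝ 1 (fun p => chartAt E b (g ((chartAt E a).symm p))) (chartAt E a x) := by
    have := (contMDiffAt_iff_of_mem_source hx hgx).1 (hg x)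
    simpa [Function.comp_def, contDiffWithinAt_univ] using this.2
  have hd := hc.hasStrictFDerivAt one_ne_zero
  convert hd using 1
  rw [TangentBundle.continuousLinearMapAt_trivializationAt hgx,
    TangentBundle.symmL_trivializationAt hx]
  have h1 : HasMFDerivAt 𝓘(ℝ, E) 𝓘(ℝ, E) (extChartAt 𝓘(ℝ, E) b) (g x) _ :=
    (mdifferentiableAt_extChartAt hgx).hasMFDerivAt
  have h2 : HasMFDerivAt 𝓘(ℝ, E) 𝓘(ℝ, E) g x _ :=
    ((hg x).mdifferentiableAt one_ne_zero).hasMFDerivAt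
  have h3 := (mdifferentiableWithinAt_extChartAt_symm (I := 𝓘(ℝ, E)) (x := a)
    ((extChartAt 𝓘(ℝ, E) a).map_source (by simpa using hx))).hasMFDerivWithinAt
  rw [ModelWithCorners.range_eq_univ, mfderivWithin_univ, hasMFDerivWithinAt_univ] at h3
  have hinv : (extChartAt 𝓘(ℝ, E) a).symm (extChartAt 𝓘(ℝ, E) a x) = x :=
    (extChartAt 𝓘(ℝ, E) a).left_inv (by simpa using hx)
  -- The base point produced by the chain rule equals `x` only propositionally; a variable `y`
  -- allows substitution in the dependent tangent spaces.
  have key : ∀ y, y = x → ∀ w : E, mfderiv 𝓘(ℝ, E) 𝓘(ℝ, E) (extChartAt 𝓘(ℝ, E) b ∘ g) y w =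
      mfderiv 𝓘(ℝ, E) 𝓘(ℝ, E) (extChartAt 𝓘(ℝ, E) b) (g x) (mfderiv 𝓘(ℝ, E) 𝓘(ℝ, E) g x w) := by
    rintro y rfl w
    rw [(h1.comp _ h2).mfderiv]
    rfl
  have h12 : MDifferentiableAt 𝓘(ℝ, E) 𝓘(ℝ, E) (extChartAt 𝓘(ℝ, E) b ∘ g)
      ((extChartAt 𝓘(ℝ, E) a).symm (extChartAt 𝓘(ℝ, E) a x)) := by
    rw [hinv]; exact (h1.comp _ h2).mdifferentiableAt
  have h4 := (h12.hasMFDerivAt.comp (extChartAt 𝓘(ℝ, E) a x) h3).mfderiv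
  have h5 : (fun p => chartAt E b (g ((chartAt E a).symm p))) =
    (extChartAt 𝓘(ℝ, E) b ∘ g) ∘ (extChartAt 𝓘(ℝ, E) a).symm := by
    ext p; simp
  have h6 : chartAt E a x = extChartAt 𝓘(ℝ, E) a x := by simp
  rw [h5, h6]
  refine Eq.trans (Eq.trans ?_ h4.symm) mfderiv_eq_fderiv
  ext w
  refine Eq.trans ?_ (key _ hinv _).symm
  simp only [ModelWithCorners.range_eq_univ, mfderivWithin_univ]
  rfl

end Chart

/-! ### The splitting in coordinates. -/

noncomputable section

section TangentChart

variable (E : Type*) [NormedAddCommGroup E] [NormedSpace ℝ E]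
  {M : Type*} [TopologicalSpace M] [ChartedSpace E M] [IsManifold 𝓘(ℝ, E) 1 M]

/-- The coordinates of tangent vectors at `x` in the chart at `a`. -/
abbrev tangentCoord (a x : M) : TangentSpace 𝓘(ℝ, E) x →L[ℝ] E :=
  (trivializationAt E (TangentSpace 𝓘(ℝ, E)) a).continuousLinearMapAt ℝ x

/-- The tangent vector at `x` with given coordinates in the chart at `a`. -/
abbrev tangentCoordSymm (a x : M) : E →L[ℝ] TangentSpace 𝓘(ℝ, E) x :=
  (trivializationAt E (TangentSpace 𝓘(ℝ, E)) a).symmL ℝ x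

variable {E}

theorem tangentCoord_symm {a x : M} (hx : x ∈ (chartAt E a).source) (v : E) :
    tangentCoord E a x (tangentCoordSymm E a x v) = v :=
  Trivialization.continuousLinearMapAt_symmL _ (by simpa using hx) v

theorem tangentCoordSymm_tangentCoord {a x : M} (hx : x ∈ (chartAt E a).source)
    (v : TangentSpace 𝓘(ℝ, E) x) : tangentCoordSymm E a x (tangentCoord E a x v) = v :=
  Trivialization.symmL_continuousLinearMapAt _ (by simpa using hx) v

theorem ContinuousOn.tangentCoord {V : Set M} {e : ∀ x : M, TangentSpace 𝓘(ℝ, E) x}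
    (he : ContinuousOn (fun x : M => (⟨x, e x⟩ : TangentBundle 𝓘(ℝ, E) M)) V) (a : M) :
    ContinuousOn (fun x => tangentCoord E a x (e x)) (V ∩ (chartAt E a).source) := by
  have h1 := (trivializationAt E (TangentSpace 𝓘(ℝ, E)) a).continuousOn
  have h2 := continuous_snd.comp_continuousOn
    (h1.comp (he.mono Set.inter_subset_left) (fun x hx => by
      rw [Trivialization.mem_source]
      simpa using hx.2))
  refine h2.congr fun x hx => ?_
  have hx' : x ∈ (trivializationAt E (TangentSpace 𝓘(ℝ, E)) a).baseSet := by simpa using hx.2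
  simp [Trivialization.continuousLinearMapAt_apply, Trivialization.coe_linearMapAt_of_mem _ hx']

variable [FiniteDimensional ℝ E] {S U : ∀ x : M, Submodule ℝ (TangentSpace 𝓘(ℝ, E) x)}

/-- The projection onto `S x` along `U x`, in the chart at `a`. -/
def coordProjection (h : ∀ x, IsCompl (S x) (U x)) (a x : M) : E →L[ℝ] E :=
  LinearMap.toContinuousLinearMap ((tangentCoord E a x).toLinearMap ∘ₗ
    (S x).projection (U x) (h x) ∘ₗ (tangentCoordSymm E a x).toLinearMap)

theorem coordProjection_apply (h : ∀ x, IsCompl (S x) (U x)) (a x : M) (v : E) :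
    coordProjection h a x v =
      tangentCoord E a x ((S x).projection (U x) (h x) (tangentCoordSymm E a x v)) := rfl

theorem tangentCoordSymm_coordProjection (h : ∀ x, IsCompl (S x) (U x)) {a x : M}
    (hx : x ∈ (chartAt E a).source) (v : E) :
    tangentCoordSymm E a x (coordProjection h a x v) =
      (S x).projection (U x) (h x) (tangentCoordSymm E a x v) := by
  rw [coordProjection_apply, tangentCoordSymm_tangentCoord hx]

theorem coordProjection_idem (h : ∀ x, IsCompl (S x) (U x)) {a x : M}
    (hx : x ∈ (chartAt E a).source) (v : E) :
    coordProjection h a x (coordProjection h a x v) = coordProjection h a x v := by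
  rw [coordProjection_apply, tangentCoordSymm_coordProjection h hx,
    Submodule.projection_apply_of_mem_left _ (Submodule.projection_apply_mem _ _),
    coordProjection_apply]

theorem coordProjection_tangentCoord (h : ∀ x, IsCompl (S x) (U x)) {a x : M}
    (hx : x ∈ (chartAt E a).source) (v : TangentSpace 𝓘(ℝ, E) x) :
    coordProjection h a x (tangentCoord E a x v) =
      tangentCoord E a x ((S x).projection (U x) (h x) v) := by
  rw [coordProjection_apply, tangentCoordSymm_tangentCoord hx]

/-- In coordinates, the projection attached to a continuous splitting is continuous. -/
theorem eventually_continuousAt_coordProjection (h : ∀ x, IsCompl (S x) (U x))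
    (hS : ContinuousSubspaceFamily S) (hU : ContinuousSubspaceFamily U) (a : M) :
    ∀ᶠ x in 𝓝 a, ContinuousAt (coordProjection h a) x := by
  obtain ⟨k, V, e, hV, hec, he⟩ := hS a
  obtain ⟨l, V', e', hV', hec', he'⟩ := hU a
  let W : Set M := interior (V ∩ V' ∩ (chartAt E a).source)
  have hW : W ∈ 𝓝 a := interior_mem_nhds.2 (Filter.inter_mem (Filter.inter_mem hV hV')
    ((chartAt E a).open_source.mem_nhds (mem_chart_source E a)))
  have hWV : W ⊆ V ∩ V' ∩ (chartAt E a).source := interior_subset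
  let ee : ∀ x : M, Fin k ⊕ Fin l → TangentSpace 𝓘(ℝ, E) x := fun x =>
    Sum.elim (fun i => e i x) (fun i => e' i x)
  have haW : a ∈ W := mem_of_mem_nhds hW
  have hli : LinearIndependent ℝ (ee a) := by
    refine LinearIndependent.sum_type (he a (hWV haW).1.1).1 (he' a (hWV haW).1.2).1 ?_
    rw [(he a (hWV haW).1.1).2, (he' a (hWV haW).1.2).2]
    exact (h a).disjoint
  have hsp : ⊤ ≤ Submodule.span ℝ (Set.range (ee a)) := by
    rw [Set.Sum.elim_range, Submodule.span_union, (he a (hWV haW).1.1).2,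
      (he' a (hWV haW).1.2).2]
    exact (h a).codisjoint.top_le
  let T : TangentSpace 𝓘(ℝ, E) a ≃ₗ[ℝ] E := LinearEquiv.ofLinearMap
    (tangentCoord E a a).toLinearMap (tangentCoordSymm E a a).toLinearMap
    (LinearMap.ext fun v => tangentCoord_symm (mem_chart_source E a) v)
    (LinearMap.ext fun v => tangentCoordSymm_tangentCoord (mem_chart_source E a) v)
  let b : Module.Basis (Fin k ⊕ Fin l) ℝ E := (Module.Basis.mk hli hsp).map T
  have hb : ∀ i, b i = tangentCoord E a a (ee a i) := by
    intro i
    simp only [b, Module.Basis.map_apply, Module.Basis.mk_apply]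
    rfl
  -- `Φ x` carries the frame at `a` to the frame at `x`, while `Ψ x` does so on the stable part and
  -- kills the rest. Thus the projection is `Ψ x * (Φ x)⁻¹`, continuous wherever `Φ` is invertible,
  -- in particular near `a` since `Φ a = 1`.
  let Φ : M → E →L[ℝ] E := fun x =>
    ∑ i, (LinearMap.toContinuousLinearMap (b.coord i)).smulRight (tangentCoord E a x (ee x i))
  let Ψ : M → E →L[ℝ] E := fun x =>
    ∑ i, (LinearMap.toContinuousLinearMap (b.coord i)).smulRight
      (Sum.elim (fun j => tangentCoord E a x (ee x (Sum.inl j))) (fun _ => 0) i)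
  have hecoord : ∀ i, ContinuousOn (fun x => tangentCoord E a x (ee x i)) W := by
    rintro (i | i)
    · exact ((hec i).tangentCoord a).mono fun x hx => ⟨(hWV hx).1.1, (hWV hx).2⟩
    · exact ((hec' i).tangentCoord a).mono fun x hx => ⟨(hWV hx).1.2, (hWV hx).2⟩
  have hsm : ∀ c : E →L[ℝ] ℝ, Continuous fun v : E => c.smulRight v := fun c =>
    (ContinuousLinearMap.smulRightL ℝ E E c).continuous
  have hΦc : ContinuousOn Φ W := by
    refine continuousOn_finsetSum _ fun i _ => ?_
    exact (hsm _).comp_continuousOn (hecoord i)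
  have hΨc : ContinuousOn Ψ W := by
    refine continuousOn_finsetSum _ fun i _ => (hsm _).comp_continuousOn ?_
    rcases i with i | i
    · exact hecoord (Sum.inl i)
    · exact continuousOn_const
  have hsum : ∀ (F : Fin k ⊕ Fin l → E) (i),
      (∑ j, (LinearMap.toContinuousLinearMap (b.coord j)).smulRight (F j)) (b i) = F i := by
    intro F i
    simp only [sum_apply, ContinuousLinearMap.smulRight_apply,
      LinearMap.coe_toContinuousLinearMap', Module.Basis.coord_apply, Module.Basis.repr_self,
      Finsupp.single_apply, ite_smul, one_smul, zero_smul, Finset.sum_ite_eq, Finset.mem_univ,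
      if_true]
  have hΦb : ∀ x i, Φ x (b i) = tangentCoord E a x (ee x i) := fun x i => hsum _ i
  have hΨb : ∀ x i, Ψ x (b i) =
      Sum.elim (fun j => tangentCoord E a x (ee x (Sum.inl j))) (fun _ => 0) i :=
    fun x i => hsum _ i
  have hΦa : Φ a = 1 := by
    refine ContinuousLinearMap.coe_injective (b.ext fun i => ?_)
    exact (hΦb a i).trans (hb i).symm
  have hPΦ : ∀ x ∈ W, coordProjection h a x * Φ x = Ψ x := by
    intro x hx
    obtain ⟨⟨hx1, hx2⟩, hx3⟩ := hWV hx
    refine ContinuousLinearMap.coe_injective (b.ext fun i => ?_)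
    change coordProjection h a x (Φ x (b i)) = Ψ x (b i)
    rw [hΦb, hΨb, coordProjection_tangentCoord h hx3]
    rcases i with i | i
    · have : e i x ∈ S x := by
        rw [← (he x hx1).2]; exact Submodule.subset_span ⟨i, rfl⟩
      simp only [ee, Sum.elim_inl]
      rw [Submodule.projection_apply_of_mem_left _ this]
    · have : e' i x ∈ U x := by
        rw [← (he' x hx2).2]; exact Submodule.subset_span ⟨i, rfl⟩
      simp only [ee, Sum.elim_inr]
      rw [(Submodule.projection_apply_eq_zero_iff _).2 this, map_zero]
  have hΦat : ContinuousAt Φ a := hΦc.continuousAt hW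
  have hunit : ∀ᶠ x in 𝓝 a, IsUnit (Φ x) :=
    hΦat.eventually (Units.isOpen.mem_nhds (by rw [hΦa]; exact isUnit_one))
  have hgood : ∀ᶠ x in 𝓝 a, x ∈ W ∧ IsUnit (Φ x) := Filter.Eventually.and hW hunit
  filter_upwards [eventually_eventually_nhds.2 hgood] with x hx
  have hxW : W ∈ 𝓝 x := hx.mono fun y hy => hy.1
  obtain ⟨u, hu⟩ := hx.self_of_nhds.2
  have hinv : ContinuousAt (fun y => Ψ y * Ring.inverse (Φ y)) x := by
    refine (hΨc.continuousAt hxW).mul ?_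
    refine ContinuousAt.comp (g := Ring.inverse) ?_ (hΦc.continuousAt hxW)
    rw [← hu]
    exact NormedRing.inverse_continuousAt u
  refine hinv.congr ?_
  filter_upwards [hx] with y hy
  rw [← hPΦ y hy.1, mul_assoc, Ring.mul_inverse_cancel _ hy.2, mul_one]

end TangentChart

end

/-! ### Smoothness and derivatives of iterates. -/

section Iterates

variable {E : Type*} [NormedAddCommGroup E] [NormedSpace ℝ E]
  {M : Type*} [TopologicalSpace M] [ChartedSpace E M]

theorem Diffeomorph.contMDiff_zpow (f : Diffeomorph 𝓘(ℝ, E) 𝓘(ℝ, E) M M 1) (n : ℤ) :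
    ContMDiff 𝓘(ℝ, E) 𝓘(ℝ, E) 1 (⇑((f.toEquiv : Equiv.Perm M) ^ n)) := by
  induction n with
  | zero => exact contMDiff_id
  | succ n ih =>
    rw [zpow_add_one]
    exact ih.comp f.contMDiff
  | pred n ih =>
    rw [zpow_sub_one]
    exact ih.comp f.symm.contMDiff

theorem mfderiv_iterate_mem {S : ∀ x : M, Submodule ℝ (TangentSpace 𝓘(ℝ, E) x)} {f : M → M} (hf : ContMDiff 𝓘(ℝ, E) 𝓘(ℝ, E) 1 f)
    (hS : ∀ x, ∀ s ∈ S x, mfderiv 𝓘(ℝ, E) 𝓘(ℝ, E) f x s ∈ S (f x)) (N : ℕ) :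
    ContMDiff 𝓘(ℝ, E) 𝓘(ℝ, E) 1 f^[N] ∧
      ∀ x, ∀ s ∈ S x, mfderiv 𝓘(ℝ, E) 𝓘(ℝ, E) f^[N] x s ∈ S (f^[N] x) := by
  induction N with
  | zero =>
    refine ⟨contMDiff_id, fun x s hs => ?_⟩
    change mfderiv 𝓘(ℝ, E) 𝓘(ℝ, E) id x s ∈ S x
    rw [mfderiv_id]
    exact hs
  | succ N ih =>
    refine ⟨ih.1.comp hf, fun x s hs => ?_⟩
    change mfderiv 𝓘(ℝ, E) 𝓘(ℝ, E) (f^[N] ∘ f) x s ∈ S (f^[N] (f x))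
    rw [mfderiv_comp x ((ih.1 _).mdifferentiableAt one_ne_zero)
      ((hf x).mdifferentiableAt one_ne_zero)]
    exact ih.2 _ _ (hS x s hs)

theorem norm_mfderiv_of_eq_id
    [RiemannianBundle (fun x : M => TangentSpace 𝓘(ℝ, E) x)] {k : M → M} (hk : k = id) (x : M) (u : TangentSpace 𝓘(ℝ, E) x) :
    ‖mfderiv 𝓘(ℝ, E) 𝓘(ℝ, E) k x u‖ = ‖u‖ := by
  subst hk
  rw [mfderiv_id]
  rfl

end Iterates

/-! ### Chart distortion and hyperbolic steps on the manifold. -/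

section Hyperbolic

variable {E : Type*} [NormedAddCommGroup E] [NormedSpace ℝ E] [FiniteDimensional ℝ E]
  {M : Type*} [TopologicalSpace M] [ChartedSpace E M] [IsManifold 𝓘(ℝ, E) 1 M]
  [RiemannianBundle (fun x : M => TangentSpace 𝓘(ℝ, E) x)]
  {S U : ∀ x : M, Submodule ℝ (TangentSpace 𝓘(ℝ, E) x)}

/-- The chart at `a` distorts the geometry of the splitting at `x` by at most the factor `B`. -/
structure ChartBound (h : ∀ x, IsCompl (S x) (U x)) (a : M) (B : ℝ) (x : M) : Prop where
  mem_source : x ∈ (chartAt E a).source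
  continuousAt : ContinuousAt (coordProjection h a) x
  norm_projection_le : ‖coordProjection h a x‖ ≤ B
  norm_coord_le : ∀ v : TangentSpace 𝓘(ℝ, E) x, ‖tangentCoord E a x v‖ ≤ B * ‖v‖
  norm_coordSymm_le : ∀ v : E, ‖tangentCoordSymm E a x v‖ ≤ B * ‖v‖

theorem ChartBound.mono {h : ∀ x, IsCompl (S x) (U x)} {a : M} {B B' : ℝ} {x : M}
    (hB : ChartBound h a B x) (hBB' : B ≤ B') : ChartBound h a B' x where
  mem_source := hB.mem_source
  continuousAt := hB.continuousAt
  norm_projection_le := hB.norm_projection_le.trans hBB'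
  norm_coord_le v := (hB.norm_coord_le v).trans (mul_le_mul_of_nonneg_right hBB' (norm_nonneg v))
  norm_coordSymm_le v :=
    (hB.norm_coordSymm_le v).trans (mul_le_mul_of_nonneg_right hBB' (norm_nonneg v))

theorem exists_eventually_chartBound
    [IsContinuousRiemannianBundle E (fun x : M => TangentSpace 𝓘(ℝ, E) x)]
    (h : ∀ x, IsCompl (S x) (U x)) (hS : ContinuousSubspaceFamily S)
    (hU : ContinuousSubspaceFamily U) (a : M) : ∃ B, ∀ᶠ x in 𝓝 a, ChartBound h a B x := by
  obtain ⟨B₁, -, h₁⟩ :=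
    eventually_norm_trivializationAt_lt E (fun x : M => TangentSpace 𝓘(ℝ, E) x) a
  obtain ⟨B₂, -, h₂⟩ :=
    eventually_norm_symmL_trivializationAt_lt E (fun x : M => TangentSpace 𝓘(ℝ, E) x) a
  have hc := eventually_continuousAt_coordProjection h hS hU a
  have h₃ : ∀ᶠ x in 𝓝 a, ‖coordProjection h a x‖ < ‖coordProjection h a a‖ + 1 :=
    hc.self_of_nhds.norm.eventually (gt_mem_nhds (lt_add_one _))
  have h₄ := (chartAt E a).open_source.mem_nhds (mem_chart_source E a)
  refine ⟨max (max B₁ B₂) (‖coordProjection h a a‖ + 1), ?_⟩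
  filter_upwards [h₁, h₂, hc, h₃, h₄] with x hx₁ hx₂ hx hx₃ hx₄
  refine ⟨hx₄, hx, hx₃.le.trans (le_max_right _ _), fun v => ?_, fun v => ?_⟩
  · refine (ContinuousLinearMap.le_opNorm _ v).trans (mul_le_mul_of_nonneg_right
      (hx₁.le.trans ((le_max_left _ _).trans (le_max_left _ _))) (norm_nonneg v))
  · refine (ContinuousLinearMap.le_opNorm _ v).trans (mul_le_mul_of_nonneg_right
      (hx₂.le.trans ((le_max_right _ _).trans (le_max_left _ _))) (norm_nonneg v))

theorem exists_finite_chartBound [CompactSpace M] [RegularSpace M]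
    [IsContinuousRiemannianBundle E (fun x : M => TangentSpace 𝓘(ℝ, E) x)]
    (h : ∀ x, IsCompl (S x) (U x)) (hS : ContinuousSubspaceFamily S)
    (hU : ContinuousSubspaceFamily U) :
    ∃ (t : Finset M) (C : M → Set M) (B : ℝ), 0 ≤ B ∧ (∀ a, IsClosed (C a)) ∧
      (∀ x, ∃ a ∈ t, x ∈ C a) ∧ ∀ a ∈ t, ∀ x ∈ C a, ChartBound h a B x := by
  choose B hB using exists_eventually_chartBound h hS hU
  choose C hC hCc hCB using fun a => exists_mem_nhds_isClosed_subset (hB a)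
  obtain ⟨t, -, ht⟩ := isCompact_univ.elim_nhds_subcover C fun a _ => hC a
  refine ⟨t, C, ∑ a ∈ t, |B a|, Finset.sum_nonneg fun a _ => abs_nonneg _, hCc, fun x => ?_,
    fun a ha x hx => (hCB a hx).mono ((le_abs_self _).trans
      (Finset.single_le_sum (f := fun a => |B a|) (fun a _ => abs_nonneg _) ha))⟩
  simpa using ht (Set.mem_univ x)

/-- `g` preserves the splitting, contracts `S` and expands `U` by the factor `c`. -/
structure IsHyperbolicMap (S U : ∀ x : M, Submodule ℝ (TangentSpace 𝓘(ℝ, E) x)) (g : M → M)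
    (c : ℝ) : Prop where
  contMDiff : ContMDiff 𝓘(ℝ, E) 𝓘(ℝ, E) 1 g
  injective : ∀ x, Function.Injective (mfderiv 𝓘(ℝ, E) 𝓘(ℝ, E) g x)
  map_stable : ∀ x, ∀ s ∈ S x, mfderiv 𝓘(ℝ, E) 𝓘(ℝ, E) g x s ∈ S (g x)
  map_unstable : ∀ x, ∀ u ∈ U x, mfderiv 𝓘(ℝ, E) 𝓘(ℝ, E) g x u ∈ U (g x)
  contract : ∀ x, ∀ s ∈ S x, ‖mfderiv 𝓘(ℝ, E) 𝓘(ℝ, E) g x s‖ ≤ c * ‖s‖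
  expand : ∀ x, ∀ u ∈ U x, ‖u‖ ≤ c * ‖mfderiv 𝓘(ℝ, E) 𝓘(ℝ, E) g x u‖

theorem IsHyperbolicMap.exists_step {g : M → M} {c : ℝ} (hg : IsHyperbolicMap S U g c)
    (h : ∀ x, IsCompl (S x) (U x)) {a b x : M} {B : ℝ} (hc : 0 ≤ c) (hB : 0 ≤ B)
    (hcB : B * c * B * (1 + B) < 1 / 4) (hx : ChartBound h a B x)
    (hgx : ChartBound h b B (g x)) :
    ∃ η : ℝ, 0 < η ∧ ∃ V ∈ 𝓝 (g x), ∀ᶠ y in 𝓝 x, ∀ y' ∈ V,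
      (∀ v, ‖v‖ ≤ η → chartAt E a y + v ∈ (chartAt E a).target ∧
        g ((chartAt E a).symm (chartAt E a y + v)) ∈ (chartAt E b).source) ∧
      ∃ R, IsHyperbolicStep (coordProjection h a y) (coordProjection h b y') R
        (fun v => chartAt E b (g ((chartAt E a).symm (chartAt E a y + v))) - chartAt E b y') η := by
  have hstrict := hasStrictFDerivAt_chart_rep hg.contMDiff hx.mem_source hgx.mem_source
  set A : E →L[ℝ] E := tangentCoord E b (g x) ∘L mfderiv 𝓘(ℝ, E) 𝓘(ℝ, E) g x ∘L
    tangentCoordSymm E a x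
  have hAv : ∀ v, A v = tangentCoord E b (g x)
      (mfderiv 𝓘(ℝ, E) 𝓘(ℝ, E) g x (tangentCoordSymm E a x v)) := fun v => rfl
  have hAsymm : ∀ v, tangentCoordSymm E b (g x) (A v) =
      mfderiv 𝓘(ℝ, E) 𝓘(ℝ, E) g x (tangentCoordSymm E a x v) := fun v => by
    rw [hAv, tangentCoordSymm_tangentCoord hgx.mem_source]
  have hinj : Function.Injective A := by
    intro v w hvw
    have h1 := hg.injective x ((hAsymm v).symm.trans
      ((congrArg (tangentCoordSymm E b (g x)) hvw).trans (hAsymm w)))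
    rw [← tangentCoord_symm hx.mem_source v, h1, tangentCoord_symm hx.mem_source]
  -- A linear map that respects both summands commutes with the projections.
  have hcomm : ∀ v : TangentSpace 𝓘(ℝ, E) x,
      mfderiv 𝓘(ℝ, E) 𝓘(ℝ, E) g x ((S x).projection (U x) (h x) v) =
      (S (g x)).projection (U (g x)) (h (g x)) (mfderiv 𝓘(ℝ, E) 𝓘(ℝ, E) g x v) := by
    intro v
    have h1 := hg.map_stable x _ (Submodule.projection_apply_mem (h x) v)
    have h2 := hg.map_unstable x _ (Submodule.sub_projection_mem (h x) v)
    rw [map_sub] at h2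
    have h3 := (Submodule.projection_apply_eq_zero_iff (h (g x))).2 h2
    rw [map_sub, Submodule.projection_apply_of_mem_left _ h1, sub_eq_zero] at h3
    exact h3.symm
  have hAP : ∀ v, A (coordProjection h a x v) = coordProjection h b (g x) (A v) := by
    intro v
    rw [coordProjection_apply h b, hAsymm, ← hcomm, hAv,
      tangentCoordSymm_coordProjection h hx.mem_source]
  obtain ⟨R, hPR, hRA, hker, hR⟩ := exists_partial_inverse (q := B * c * B) hinj
    (coordProjection_idem h hgx.mem_source) hAP (by positivity) (fun v hv => by
      have hu : tangentCoordSymm E a x v ∈ U x := by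
        rw [← Submodule.projection_apply_eq_zero_iff (h x),
          ← tangentCoordSymm_coordProjection h hx.mem_source, hv, map_zero]
      have h1 := hx.norm_coord_le (tangentCoordSymm E a x v)
      rw [tangentCoord_symm hx.mem_source] at h1
      have h2 := hg.expand x _ hu
      rw [← hAsymm] at h2
      have h3 := hgx.norm_coordSymm_le (A v)
      calc ‖v‖ ≤ B * (c * (B * ‖A v‖)) := by
            refine h1.trans (mul_le_mul_of_nonneg_left ?_ hB)
            exact h2.trans (mul_le_mul_of_nonneg_left h3 hc)
        _ = B * c * B * ‖A v‖ := by ring) hgx.norm_projection_le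
  -- By `hAP` one may project first, then contract: two coordinate changes and the projection cost
  -- `B` each, the contraction gives `c`.
  have hPA : ‖coordProjection h b (g x) ∘L A‖ < 1 / 4 := by
    refine lt_of_le_of_lt (ContinuousLinearMap.opNorm_le_bound _ (M := B * c * B * B)
      (by positivity) fun v => ?_) (lt_of_le_of_lt ?_ hcB)
    · rw [ContinuousLinearMap.comp_apply, ← hAP, hAv,
        tangentCoordSymm_coordProjection h hx.mem_source]
      have h1 := hg.contract x _
        (Submodule.projection_apply_mem (h x) (tangentCoordSymm E a x v))
      have h2 := hx.norm_coordSymm_le (coordProjection h a x v)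
      rw [tangentCoordSymm_coordProjection h hx.mem_source] at h2
      have h3 := (coordProjection h a x).le_of_opNorm_le hx.norm_projection_le v
      calc _ ≤ B * (c * (B * (B * ‖v‖))) := by
            refine (hgx.norm_coord_le _).trans (mul_le_mul_of_nonneg_left ?_ hB)
            refine h1.trans (mul_le_mul_of_nonneg_left ?_ hc)
            exact h2.trans (mul_le_mul_of_nonneg_left h3 hB)
        _ = B * c * B * B * ‖v‖ := by ring
    · exact mul_le_mul_of_nonneg_left (by linarith) (by positivity)
  have hsource := (chartAt E a).open_source.mem_nhds hx.mem_source
  have hcont : ContinuousAt (chartAt E a) x := (chartAt E a).continuousAt hx.mem_source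
  obtain ⟨η₁, hη₁, V, hV, hstep⟩ := eventually_isHyperbolicStep (κ := chartAt E a)
    (κ' := chartAt E b) hcont hx.continuousAt hgx.continuousAt hstrict
    (by filter_upwards [hsource] with y hy using coordProjection_idem h hy)
    hPR hRA hker (hR.trans_lt hcB) hPA
  have hdom : {p | p ∈ (chartAt E a).target ∧ g ((chartAt E a).symm p) ∈ (chartAt E b).source} ∈
      𝓝 (chartAt E a x) := by
    have hmem := (chartAt E a).map_source hx.mem_source
    have hg' : ContinuousAt (fun p => g ((chartAt E a).symm p)) (chartAt E a x) :=
      hg.contMDiff.continuous.continuousAt.comp ((chartAt E a).continuousAt_symm hmem)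
    refine Filter.inter_mem ((chartAt E a).open_target.mem_nhds hmem)
      (hg' ((chartAt E b).open_source.mem_nhds ?_))
    simp only [(chartAt E a).left_inv hx.mem_source]
    exact hgx.mem_source
  obtain ⟨r, hr, hrd⟩ := Metric.mem_nhds_iff.1 hdom
  refine ⟨min η₁ (r / 3), by positivity, V, hV, ?_⟩
  filter_upwards [hstep, hcont (Metric.ball_mem_nhds _ (half_pos hr))] with y hy hyr y' hy'
  obtain ⟨R', hR'⟩ := hy y' hy'
  refine ⟨fun v hv => hrd ?_, R', hR'.mono (min_le_left _ _)⟩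
  have h1 : dist (chartAt E a y) (chartAt E a x) < r / 2 := hyr
  have h2 := dist_triangle (chartAt E a y + v) (chartAt E a y) (chartAt E a x)
  rw [dist_self_add_left] at h2
  rw [Metric.mem_ball]
  linarith [hv.trans (min_le_right _ _)]

end Hyperbolic

/-! ### From an Anosov diffeomorphism to a hyperbolic atlas. -/

section Anosov

variable {E : Type*} [NormedAddCommGroup E] [NormedSpace ℝ E] [FiniteDimensional ℝ E]
  {M : Type*} [EMetricSpace M] [ChartedSpace E M] [IsManifold 𝓘(ℝ, E) 1 M]

variable [RiemannianBundle (fun x : M => TangentSpace 𝓘(ℝ, E) x)]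
  [IsContinuousRiemannianBundle E (fun x : M => TangentSpace 𝓘(ℝ, E) x)]

/-- Some power of an Anosov diffeomorphism of a compact manifold has a hyperbolic atlas. -/
theorem IsAnosov.exists_isHyperbolicAtlas [CompactSpace M]
    {f : Diffeomorph 𝓘(ℝ, E) 𝓘(ℝ, E) M M 1} (hf : IsAnosov f) :
    ∃ (N : ℕ) (t : Finset M) (C : t → Set M) (P : t → M → E →L[ℝ] E), 0 < N ∧
      IsHyperbolicAtlas ⇑((f.toEquiv : Equiv.Perm M) ^ N) (fun a : t => chartAt E a.1) C P := by
  obtain ⟨K, r, S, U, hK, hr0, hr1, hS, hU, hSU, hfS, hfU, hcontr, hexp⟩ := hf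
  obtain ⟨t, C, B, hB, hCc, hcov, hbound⟩ := exists_finite_chartBound hSU hS hU
  -- `B` depends only on the metric, the splitting and the charts, so `N` may be chosen after it.
  obtain ⟨N, hN, hN0⟩ : ∃ N : ℕ, B * (K * r ^ N) * B * (1 + B) < 1 / 4 ∧ 0 < N := by
    have hlim : Filter.Tendsto (fun N : ℕ => B * (K * r ^ N) * B * (1 + B)) Filter.atTop (𝓝 0) := by
      simpa using ((((tendsto_pow_atTop_nhds_zero_of_lt_one hr0.le hr1).const_mul K).const_mul
        B).mul_const B).mul_const (1 + B)
    exact ((hlim.eventually (gt_mem_nhds (by norm_num))).and (Filter.eventually_gt_atTop 0)).exists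
  have hfS' : ∀ x, ∀ s ∈ S x, mfderiv 𝓘(ℝ, E) 𝓘(ℝ, E) f x s ∈ S (f x) := fun x s hs => by
    rw [← hfS x]; exact ⟨s, hs, rfl⟩
  have hfU' : ∀ x, ∀ u ∈ U x, mfderiv 𝓘(ℝ, E) 𝓘(ℝ, E) f x u ∈ U (f x) := fun x u hu => by
    rw [← hfU x]; exact ⟨u, hu, rfl⟩
  have hiter : (⇑((f.toEquiv : Equiv.Perm M) ^ N) : M → M) = f^[N] :=
    (Equiv.Perm.iterate_eq_pow f.toEquiv N).symm
  have hmS := (mfderiv_iterate_mem f.contMDiff hfS' N).2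
  have hmU := (mfderiv_iterate_mem f.contMDiff hfU' N).2
  rw [← hiter] at hmS hmU
  have hCN := f.contMDiff_zpow (N : ℤ)
  have hCN' := f.contMDiff_zpow (-(N : ℤ))
  rw [zpow_natCast] at hCN
  have hinv : (⇑((f.toEquiv : Equiv.Perm M) ^ (-(N : ℤ))) : M → M) ∘
      ⇑((f.toEquiv : Equiv.Perm M) ^ N) = id := by
    funext x
    rw [Function.comp_apply, ← Equiv.Perm.mul_apply, ← zpow_natCast, ← zpow_add, neg_add_cancel]
    rfl
  have hnorm : ∀ (x : M) (u : TangentSpace 𝓘(ℝ, E) x),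
      ‖mfderiv 𝓘(ℝ, E) 𝓘(ℝ, E) (⇑((f.toEquiv : Equiv.Perm M) ^ (-(N : ℤ))))
        (((f.toEquiv : Equiv.Perm M) ^ N) x)
        (mfderiv 𝓘(ℝ, E) 𝓘(ℝ, E) (⇑((f.toEquiv : Equiv.Perm M) ^ N)) x u)‖ = ‖u‖ := by
    intro x u
    rw [← norm_mfderiv_of_eq_id hinv x u,
      mfderiv_comp x ((hCN' _).mdifferentiableAt one_ne_zero)
        ((hCN x).mdifferentiableAt one_ne_zero)]
    rfl
  have hyp : IsHyperbolicMap S U ⇑((f.toEquiv : Equiv.Perm M) ^ N) (K * r ^ N) := by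
    refine ⟨hCN, fun x => ?_, hmS, hmU, fun x s hs => ?_, fun x u hu => ?_⟩
    · refine (injective_iff_map_eq_zero _).2 fun u hu => ?_
      have := hnorm x u
      rw [hu, map_zero, norm_zero] at this
      exact norm_eq_zero.1 this.symm
    · have := hcontr x s hs N (by positivity)
      rwa [zpow_natCast, zpow_natCast] at this
    -- Expansion of `u` is the backward estimate applied to its image under the derivative of `f ^
    -- N`.
    · have := hexp _ _ (hmU x u hu) (-(N : ℤ)) (by simp)
      rwa [hnorm, neg_neg, zpow_natCast] at this
  refine ⟨N, t, fun a => C a.1, fun a => coordProjection hSU a.1, hN0, ?_⟩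
  exact
    { isClosed := fun a => hCc a.1
      subset := fun a x hx => (hbound a.1 a.2 x hx).mem_source
      cover := fun x => by
        obtain ⟨a, ha, hx⟩ := hcov x
        exact ⟨⟨a, ha⟩, hx⟩
      bounded := ⟨B, fun a x hx => (hbound a.1 a.2 x hx).norm_projection_le⟩
      step := fun a b x hx hgx => hyp.exists_step hSU (by positivity) hB hN
        (hbound a.1 a.2 x hx) (hbound b.1 b.2 _ hgx) }

end Anosov

theorem mainTheorem4 {E : Type*} [NormedAddCommGroup E] [NormedSpace ℝ E] [FiniteDimensional ℝ E]
    {M : Type*} [EMetricSpace M] [CompactSpace M] [ChartedSpace E M] [IsManifold 𝓘(ℝ, E) 1 M]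
    [RiemannianBundle (fun x : M => TangentSpace 𝓘(ℝ, E) x)]
    [IsContinuousRiemannianBundle E (fun x : M => TangentSpace 𝓘(ℝ, E) x)]
    [IsRiemannianManifold 𝓘(ℝ, E) M]
    (f : Diffeomorph 𝓘(ℝ, E) 𝓘(ℝ, E) M M 1) (hf : IsAnosov f) :
    (∃ ρ : ℝ, IsExpansivityConstant f.toEquiv ρ) ∧
    ∀ ρ : ℝ, IsExpansivityConstant f.toEquiv ρ → ∀ ε : ℝ, 0 < ε → ε ≤ ρ / 2 →
      (∃ δ : ℝ, 0 < δ ∧ BracketDefined f.toEquiv ε δ) ∧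
      ∀ δ : ℝ, 0 < δ → ∀ h : BracketDefined f.toEquiv ε δ,
        ∃ ε' : ℝ, 0 < ε' ∧ ∀ x : M,
          ∃ (hsub : ∀ z ∈ localUnstableSet f.toEquiv ε' x, ∀ w ∈ localStableSet f.toEquiv ε' x,
              edist z w < ENNReal.ofReal δ)
            (V : Set M)
            (φ : ↥(localUnstableSet f.toEquiv ε' x) × ↥(localStableSet f.toEquiv ε' x) ≃ₜ ↥V),
            V ∈ 𝓝 x ∧
            ∀ p, (φ p : M) = bracket h ⟨(p.1.1, p.2.1), hsub p.1.1 p.1.2 p.2.1 p.2.2⟩ := by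
  have hc : ∀ n : ℤ, Continuous ((f.toEquiv : Equiv.Perm M) ^ n) :=
    fun n => (f.contMDiff_zpow n).continuous
  have : CompleteSpace E := FiniteDimensional.complete ℝ E
  obtain ⟨N, t, C, P, hN, hatlas⟩ := hf.exists_isHyperbolicAtlas
  have hcN : Continuous ((f.toEquiv : Equiv.Perm M) ^ N) := by
    simpa using hc N
  exact ⟨exists_isExpansivityConstant_of_pow (hatlas.exists_expansive hcN),
    fun ρ hρ ε hε hερ => localProductStructure_of_hasLocalIntersections hc
      (hasLocalIntersections_of_pow hc hN (hatlas.hasLocalIntersections hcN)) hρ hε hερ⟩
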